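/- Fix constants $a\ge b>0$ and a sequence $\alpha=\alpha_n\in(0,\tfrac12)$. For each $n$ let $x^*\in\{1,-1\}^n$ be a vector of i.i.d. uniform labels (respectively, for even $n$, a uniformly random label vector with exactly $n/2$ labels of each sign). Given $x^*$, let $G$ be a random graph on $n$ nodes in which distinct nodes $i,j$ are joined independently with probability $p=a\frac{\log n}{n}$ if $x^*_i=x^*_j$ and $q=b\frac{\log n}{n}$ if $x^*_i\neq x^*_j$ ($n$ is taken so large that $p,q\le1$). Independently of $G$ given $x^*$, each node reveals a noisy label $y_i$; these are independent with $y_i=x^*_i$ with probability $1-\alpha$ and $y_i=-x^*_i$ with probability $\alpha$. An estimator is a function $\hat x=\hat x(G,y)\in\{1,-1\}^n$, and it fails if $\hat x\neq x^*$. A maximum likelihood detector returns a maximizer of $\mathbb P(G,y\mid x)$ over the label vectors $x$ that are possible values of $x^*$, ties being broken arbitrarily. Put $c=\log\frac{1-\alpha}{\alpha}$, $T=\log\frac ab$, $\gamma=\sqrt{\beta^2+abT^2}$ and $$\eta(a,b,\beta)=a+b+\beta-\frac{2\gamma}{T}+\frac{\beta}{T}\log\Big(\frac{\gamma+\beta}{\gamma-\beta}\Big).$$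 **Theorem.** The failure probability of maximum likelihood, and hence of every estimator, is bounded away from zero, i.e. there are $\delta>0$ and $n_0$ (depending only on $a$, $b$ and the sequence $\alpha$) such that for all $n\ge n_0$ every maximum likelihood detector, and every estimator, fails with probability at least $\delta$, in each of the following cases: 1. $c=o(\log n)$ and $(\sqrt a-\sqrt b)^2<2$; 2. $c=(\beta+o(1))\log n$ for a constant $\beta$ with $0<\beta<\frac{T(a-b)}{2}$, and $\eta(a,b,\beta)<2$; 3. $c=(\beta+o(1))\log n$ for a constant $\beta$ with $\beta>\frac{T(a-b)}{2}$, and $\beta<1$. This holds for both label models above (for the model with two communities of size $n/2$, for even $n\ge n_0$). -/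

import Mathlib

namespace NoisySBM

/-- A vector of `n` community labels, each of them `1` or `-1` (the units of `ℤ`). The same type is
used for the vector of noisy labels. -/
abbrev Labels (n : ℕ) : Type := Fin n → ℤˣ

/-- The probability `s * log n / n`. With `s = a` this is the probability `p` of an edge inside a
community, with `s = b` the probability `q` of an edge across the communities. -/
noncomputable def edgeProb (s : ℝ) (n : ℕ) : ℝ := s * Real.log n / n

open Classical in
/-- `P(G | x)`: given the labels `x`, the pairs `i < j` of vertices are independently joined by an
edge, with probability `p` if `x i = x j` and with probability `q` otherwise. -/
noncomputable def graphProb (a b : ℝ) {n : ℕ} (x : Labels n) (G : SimpleGraph (Fin n)) : ℝ :=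
  ∏ e : Fin n × Fin n with e.1 < e.2,
    if G.Adj e.1 e.2 then edgeProb (if x e.1 = x e.2 then a else b) n
    else 1 - edgeProb (if x e.1 = x e.2 then a else b) n

/-- `P(y | x)`: given the labels `x`, the noisy labels are independent, each of them equal to the
true label with probability `1 - α` and to its negative with probability `α`. -/
noncomputable def noiseProb (α : ℝ) {n : ℕ} (x y : Labels n) : ℝ :=
  ∏ i, if y i = x i then 1 - α else α

/-- `P(G, y | x)`: the graph and the noisy labels are independent given the labels `x`. -/
noncomputable def likelihood (a b α : ℝ) {n : ℕ} (x : Labels n) (G : SimpleGraph (Fin n))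
    (y : Labels n) : ℝ :=
  graphProb a b x G * noiseProb α x y

/-- An estimator (detector) of the labels from the observed graph and the noisy labels. -/
abbrev Estimator (n : ℕ) : Type := SimpleGraph (Fin n) → Labels n → Labels n

/-- `g` is a maximum likelihood detector over the set `S` of label vectors: it always returns an
element of `S` with maximal likelihood. Ties may be broken in any way. -/
def IsMaximumLikelihood (a b α : ℝ) {n : ℕ} (S : Finset (Labels n)) (g : Estimator n) : Prop :=
  ∀ G y, g G y ∈ S ∧ ∀ x ∈ S, likelihood a b α x G y ≤ likelihood a b α (g G y) G y

open Classical in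
/-- The probability that `g` fails, i.e. that `g (G, y) ≠ x`, when the true label vector `x` is
uniform on `S` and `(G, y)` has the law `P(G, y | x)`. -/
noncomputable def failureProb (a b α : ℝ) {n : ℕ} (S : Finset (Labels n)) (g : Estimator n) : ℝ :=
  (∑ x ∈ S, ∑ G : SimpleGraph (Fin n), ∑ y : Labels n,
    if g G y ≠ x then likelihood a b α x G y else 0) / (S.card : ℝ)

/-- All label vectors. The uniform law on this set is that of `n` independent labels, each equal
to `1` or `-1` with probability `1 / 2`. -/
def allLabels (n : ℕ) : Finset (Labels n) := Finset.univ

/-- The label vectors with two communities of the same size (there are none if `n` is odd). -/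
def balancedLabels (n : ℕ) : Finset (Labels n) :=
  {x : Labels n | Finset.card {i | x i = 1} = Finset.card {i | x i = -1}}

/-- The failure probability of every maximum likelihood detector, and indeed that of every
estimator, is at least `δ` when the labels are uniform on `S`. -/
def FailsAtLeast (a b α δ : ℝ) {n : ℕ} (S : Finset (Labels n)) : Prop :=
  (∀ g : Estimator n, IsMaximumLikelihood a b α S g → δ ≤ failureProb a b α S g) ∧
  (∀ g : Estimator n, δ ≤ failureProb a b α S g)

/-- The failure probability is bounded away from zero: for some `δ > 0` it is at least `δ` for all
large `n`, both for independent uniform labels and (`n` even) for uniform labels with two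
communities of size `n / 2`. -/
def FailureBoundedAwayFromZero (a b : ℝ) (α : ℕ → ℝ) : Prop :=
  ∃ δ : ℝ, 0 < δ ∧ ∀ᶠ n : ℕ in Filter.atTop,
    FailsAtLeast a b (α n) δ (allLabels n) ∧
    (Even n → FailsAtLeast a b (α n) δ (balancedLabels n))

/-- `c = log ((1 - α) / α)`. -/
noncomputable def noiseLLR (α : ℝ) : ℝ := Real.log ((1 - α) / α)

/-- `T = log (a / b)`. -/
noncomputable def T (a b : ℝ) : ℝ := Real.log (a / b)

/-- `γ = √(β² + a b T²)`. -/
noncomputable def gamma (a b β : ℝ) : ℝ := Real.sqrt (β ^ 2 + a * b * T a b ^ 2)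

/-- `η(a, b, β) = a + b + β - 2 γ / T + (β / T) log ((γ + β) / (γ - β))`. -/
noncomputable def eta (a b β : ℝ) : ℝ :=
  a + b + β - 2 * gamma a b β / T a b
    + β / T a b * Real.log ((gamma a b β + β) / (gamma a b β - β))

end NoisySBM

/-! Exchange the labels of a vertex `i` labelled `1` and a vertex `j` labelled `-1`. This stays
inside either label model, and it does not lower the likelihood if both noisy labels are wrong, `i`
and `j` are not adjacent, and for both the number of neighbours of their own kind minus that of the
other kind is some `D` with `T * D` below `c` up to a vanishing correction
(`likelihood_le_likelihood_swapLabels`). If such a competitor exists with probability at least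
`1/4`, no estimator can separate it from the truth, and every estimator fails with probability at
least `1/16` (`le_failureProb_of_forall_le`).

To find `i` and `j`, fix `h` vertices of each community, `h` of order `n / log n`, with union `H`.
Counting only neighbours outside `H` makes the vertices of `H` independent. Each is misled, with
about `σ log n` neighbours of its own kind and `τ log n` of the other, with probability at least `n
^ (-(rate a σ + rate b τ + β) - o(1))`, where `n ^ (-β)` is the price of a wrong noisy label. If the
exponent sum is below `1`, both communities contain a misled vertex with probability at least `1/2`;
as `H` is small, such a pair has no neighbours in `H` with probability at least another `1/2`
(`le_coins_real_exists_swap`).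

It remains to make `rate a σ + rate b τ` small subject to `T * (σ - τ) ≤ β`. If the typical degrees
`σ = a/2`, `τ = b/2` satisfy this strictly, the rate is zero (case 3). Otherwise the minimum lies on
the line `T * (σ - τ) = β`, where stationarity reads `4στ = ab`; the value gives `η / 2` (case 2),
and `(√a - √b)² / 2` when `β = 0` (case 1). -/

namespace NoisySBM

/-! ### Likelihood ratios when labels are flipped or swapped -/

open Finset

/-- The contribution of the pair `u, v` of vertices to `graphProb`. -/
noncomputable def pairFactor (a b : ℝ) {n : ℕ} (x : Labels n) (G : SimpleGraph (Fin n))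
    (u v : Fin n) : ℝ :=
  open Classical in
  if G.Adj u v then edgeProb (if x u = x v then a else b) n
  else 1 - edgeProb (if x u = x v then a else b) n

theorem pairFactor_comm (a b : ℝ) {n : ℕ} (x : Labels n) (G : SimpleGraph (Fin n))
    (u v : Fin n) : pairFactor a b x G u v = pairFactor a b x G v u := by
  by_cases h : G.Adj u v
  · simp [pairFactor, eq_comm (a := x u), h, h.symm]
  · simp [pairFactor, eq_comm (a := x u), h, mt (fun h' : G.Adj v u => h'.symm) h]

/-- A product over all unordered pairs splits into the pairs avoiding `i` and the pairs at `i`. -/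
theorem prod_pairs_eq_mul_prod_erase {n : ℕ} (f : Fin n → Fin n → ℝ)
    (hf : ∀ u v, f u v = f v u) (i : Fin n) :
    ∏ e : Fin n × Fin n with e.1 < e.2, f e.1 e.2
      = (∏ e : Fin n × Fin n with e.1 < e.2 ∧ e.1 ≠ i ∧ e.2 ≠ i, f e.1 e.2)
        * ∏ v ∈ univ.erase i, f i v := by
  classical
  rw [← prod_filter_mul_prod_filter_not _ (fun e : Fin n × Fin n => e.1 ≠ i ∧ e.2 ≠ i)]
  congr 1
  · rw [filter_filter]
  · rw [filter_filter]
    refine prod_nbij' (fun e => if e.1 = i then e.2 else e.1)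
      (fun v => (min i v, max i v)) ?_ ?_ ?_ ?_ ?_
    · rintro ⟨u, v⟩ h
      simp only [mem_filter, mem_univ, true_and, mem_erase, and_true] at h ⊢
      grind
    · intro v h
      simp only [mem_filter, mem_univ, true_and, mem_erase, and_true] at h ⊢
      grind
    · rintro ⟨u, v⟩ h
      simp only [mem_filter, mem_univ, true_and, Prod.mk.injEq] at h ⊢
      grind
    · intro v h
      simp only [mem_erase, mem_univ, and_true] at h ⊢
      grind
    · rintro ⟨u, v⟩ h
      simp only [mem_filter, mem_univ, true_and] at h ⊢
      grind

theorem graphProb_eq_mul (a b : ℝ) {n : ℕ} (x : Labels n) (G : SimpleGraph (Fin n)) (i : Fin n) :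
    graphProb a b x G
      = (∏ e : Fin n × Fin n with e.1 < e.2 ∧ e.1 ≠ i ∧ e.2 ≠ i, pairFactor a b x G e.1 e.2)
        * ∏ v ∈ univ.erase i, pairFactor a b x G i v := by
  rw [← prod_pairs_eq_mul_prod_erase _ (pairFactor_comm a b x G) i]
  rfl

/-- The label vector with the label of `i` negated. -/
def flipLabel {n : ℕ} (x : Labels n) (i : Fin n) : Labels n := Function.update x i (-x i)

theorem flipLabel_self {n : ℕ} (x : Labels n) (i : Fin n) : flipLabel x i i = -x i := by
  simp [flipLabel]

theorem flipLabel_of_ne {n : ℕ} (x : Labels n) {i v : Fin n} (h : v ≠ i) :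
    flipLabel x i v = x v := by
  simp [flipLabel, h]

/-- The absence log-ratio `log ((1 - q) / (1 - p))`. -/
noncomputable def absentLLR (a b : ℝ) (n : ℕ) : ℝ :=
  Real.log ((1 - edgeProb b n) / (1 - edgeProb a n))

/-- Number of neighbours of `i` with the label of `i`, minus the number of those with the other
label. -/
noncomputable def degreeDiff {n : ℕ} (x : Labels n) (G : SimpleGraph (Fin n)) (i : Fin n) : ℤ :=
  open Classical in ∑ v with G.Adj i v, ((x i * x v : ℤˣ) : ℤ)

theorem units_mul_eq_ite (s t : ℤˣ) : ((s * t : ℤˣ) : ℤ) = if s = t then 1 else -1 := by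
  rcases Int.units_eq_one_or s with rfl | rfl <;> rcases Int.units_eq_one_or t with rfl | rfl <;>
    simp

theorem units_ne_iff {s t : ℤˣ} : s ≠ t ↔ s = -t := by
  rcases Int.units_eq_one_or s with rfl | rfl <;> rcases Int.units_eq_one_or t with rfl | rfl <;>
    simp

theorem units_neg_eq_iff {s t : ℤˣ} : -s = t ↔ s ≠ t := by
  rw [units_ne_iff, neg_eq_iff_eq_neg]

section

variable {a b : ℝ} {n : ℕ}

theorem edgeProb_eq_mul_exp (hb : 0 < b) (ha : 0 < a) :
    edgeProb a n = edgeProb b n * Real.exp (T a b) := by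
  rw [T, Real.exp_log (by positivity), edgeProb, edgeProb]
  field_simp

theorem one_sub_edgeProb_eq_mul_exp (hp : edgeProb a n < 1) (hq : edgeProb b n < 1) :
    1 - edgeProb a n = (1 - edgeProb b n) * Real.exp (-absentLLR a b n) := by
  have h1 : 0 < 1 - edgeProb a n := by linarith
  have h2 : 0 < 1 - edgeProb b n := by linarith
  rw [Real.exp_neg, absentLLR, Real.exp_log (by positivity)]
  field_simp

/-- Flipping `i` interchanges `p` and `q` for the pair `i, v`, so the log-ratio is `T` for an edge
and `-absentLLR` for a non-edge, with the sign of `x i * x v`. -/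
theorem pairFactor_eq_mul_exp (hb : 0 < b) (ha : 0 < a) (hp : edgeProb a n < 1)
    (hq : edgeProb b n < 1) (x : Labels n) (G : SimpleGraph (Fin n)) {i v : Fin n} (h : v ≠ i) :
    pairFactor a b x G i v = pairFactor a b (flipLabel x i) G i v *
      Real.exp (((x i * x v : ℤˣ) : ℤ) *
        (open Classical in if G.Adj i v then T a b else -absentLLR a b n)) := by
  classical
  have hne : x i ≠ x v → -x i = x v := fun h => units_neg_eq_iff.2 h
  have hne' : x i = x v → -x i ≠ x v := fun h h' => units_neg_eq_iff.1 h' h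
  simp only [pairFactor, flipLabel_self, flipLabel_of_ne x h, units_mul_eq_ite]
  have e1 := edgeProb_eq_mul_exp (n := n) hb ha
  have e2 := one_sub_edgeProb_eq_mul_exp hp hq
  by_cases hs : x i = x v
  · by_cases hA : G.Adj i v
    · simp [hA, hs, e1]
    · simp [hA, hne' hs]
      simp [hs, e2]
  · by_cases hA : G.Adj i v
    · simp [hA, hs, hne hs, e1, mul_assoc, ← Real.exp_add]
    · simp [hA, hs, hne hs, e2, mul_assoc, ← Real.exp_add]

/-- Write the weight as `(s + t)` on the neighbours minus `t` everywhere. Non-edges then enter only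
through the imbalance of the communities; the `-1` removes the term `v = i`. -/
theorem sum_erase_units_mul_ite (x : Labels n) (G : SimpleGraph (Fin n)) (i : Fin n) (s t : ℝ) :
    ∑ v ∈ univ.erase i, (((x i * x v : ℤˣ) : ℤ) : ℝ) *
        (open Classical in if G.Adj i v then s else -t)
      = (s + t) * degreeDiff x G i - t * (((x i : ℤˣ) : ℤ) * ∑ v, ((x v : ℤˣ) : ℤ) - 1 : ℤ) := by
  classical
  have h1 : (((x i : ℤˣ) : ℤ) * ∑ v, ((x v : ℤˣ) : ℤ) - 1 : ℤ)
      = ∑ v ∈ univ.erase i, ((x i * x v : ℤˣ) : ℤ) := by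
    rw [← add_sum_erase univ _ (mem_univ i), mul_add, mul_sum]
    have : ((x i : ℤˣ) : ℤ) * (x i : ℤˣ) = 1 := by
      rw [← Units.val_mul, Int.units_mul_self, Units.val_one]
    rw [this]
    simp
  have h2 : degreeDiff x G i
      = ∑ v ∈ univ.erase i, if G.Adj i v then ((x i * x v : ℤˣ) : ℤ) else 0 := by
    rw [degreeDiff, sum_filter, ← add_sum_erase univ _ (mem_univ i)]
    simp
  rw [h1, h2]
  push_cast
  rw [mul_sum, mul_sum, ← sum_sub_distrib]
  refine sum_congr rfl fun v _ => ?_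
  split_ifs <;> ring

theorem edgeProb_nonneg {s : ℝ} (hs : 0 ≤ s) (n : ℕ) : 0 ≤ edgeProb s n := by
  unfold edgeProb
  have := Real.log_natCast_nonneg n
  positivity

theorem pairFactor_nonneg (hb : 0 < b) (ha : 0 < a) (hp : edgeProb a n < 1)
    (hq : edgeProb b n < 1) (x : Labels n) (G : SimpleGraph (Fin n)) (u v : Fin n) :
    0 ≤ pairFactor a b x G u v := by
  have h1 := edgeProb_nonneg ha.le n
  have h2 := edgeProb_nonneg hb.le n
  unfold pairFactor
  split_ifs <;> linarith

theorem noiseProb_nonneg {α : ℝ} (h0 : 0 < α) (h1 : α < 1 / 2) (x y : Labels n) :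
    0 ≤ noiseProb α x y := by
  refine prod_nonneg fun i _ => ?_
  split_ifs <;> linarith

theorem graphProb_nonneg (hb : 0 < b) (ha : 0 < a) (hp : edgeProb a n < 1)
    (hq : edgeProb b n < 1) (x : Labels n) (G : SimpleGraph (Fin n)) : 0 ≤ graphProb a b x G :=
  prod_nonneg fun e _ => pairFactor_nonneg hb ha hp hq x G e.1 e.2

theorem likelihood_nonneg (hb : 0 < b) (ha : 0 < a) (hp : edgeProb a n < 1)
    (hq : edgeProb b n < 1) {α : ℝ} (h0 : 0 < α) (h1 : α < 1 / 2)
    (x : Labels n) (G : SimpleGraph (Fin n)) (y : Labels n) : 0 ≤ likelihood a b α x G y :=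
  mul_nonneg (graphProb_nonneg hb ha hp hq x G) (noiseProb_nonneg h0 h1 x y)

theorem noiseLLR_nonneg {α : ℝ} (h0 : 0 < α) (h1 : α < 1 / 2) : 0 ≤ noiseLLR α := by
  refine Real.log_nonneg ?_
  rw [le_div_iff₀ h0]
  linarith

theorem noiseProb_flipLabel {α : ℝ} (h0 : 0 < α) (h1 : α < 1 / 2) {x y : Labels n} {i : Fin n}
    (hy : y i ≠ x i) :
    noiseProb α (flipLabel x i) y = noiseProb α x y * Real.exp (noiseLLR α) := by
  have h2 : 0 < 1 - α := by linarith
  rw [noiseProb, noiseProb, ← mul_prod_erase univ _ (mem_univ i),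
    ← mul_prod_erase univ (fun k => if y k = x k then 1 - α else α) (mem_univ i)]
  have : ∏ k ∈ univ.erase i, (if y k = flipLabel x i k then 1 - α else α)
      = ∏ k ∈ univ.erase i, (if y k = x k then 1 - α else α) :=
    prod_congr rfl fun k hk => by rw [flipLabel_of_ne x (ne_of_mem_erase hk)]
  rw [this, flipLabel_self, if_pos (units_ne_iff.1 hy), if_neg hy, noiseLLR,
    Real.exp_log (by positivity)]
  field_simp

theorem graphProb_eq_mul_exp (hb : 0 < b) (ha : 0 < a) (hp : edgeProb a n < 1)
    (hq : edgeProb b n < 1) (x : Labels n) (G : SimpleGraph (Fin n)) (i : Fin n) :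
    graphProb a b x G = graphProb a b (flipLabel x i) G *
      Real.exp ((T a b + absentLLR a b n) * degreeDiff x G i - absentLLR a b n *
        (((x i : ℤˣ) : ℤ) * ∑ v, ((x v : ℤˣ) : ℤ) - 1 : ℤ)) := by
  rw [graphProb_eq_mul a b x G i, graphProb_eq_mul a b (flipLabel x i) G i,
    ← sum_erase_units_mul_ite, Real.exp_sum, mul_assoc, ← prod_mul_distrib]
  congr 1
  · refine prod_congr rfl fun e he => ?_
    simp only [mem_filter] at he
    rw [pairFactor, pairFactor, flipLabel_of_ne x he.2.2.1, flipLabel_of_ne x he.2.2.2]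
  · exact prod_congr rfl fun v hv => pairFactor_eq_mul_exp hb ha hp hq x G (ne_of_mem_erase hv)

theorem edgeProb_mono (hab : b ≤ a) : edgeProb b n ≤ edgeProb a n := by
  unfold edgeProb
  have := Real.log_natCast_nonneg n
  gcongr

theorem absentLLR_nonneg (hab : b ≤ a) (hp : edgeProb a n < 1) :
    0 ≤ absentLLR a b n := by
  refine Real.log_nonneg ?_
  rw [le_div_iff₀ (by linarith)]
  linarith [edgeProb_mono (n := n) hab]

/-- Negating the label of `i` does not decrease the likelihood if the noisy label of `i` is wrong
and `i` has not too many neighbours of its own kind. -/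
theorem likelihood_le_likelihood_flipLabel (hb : 0 < b) (hab : b ≤ a) (hp : edgeProb a n < 1)
    {α : ℝ} (h0 : 0 < α) (h1 : α < 1 / 2)
    {x y : Labels n} {G : SimpleGraph (Fin n)} {i : Fin n} (hy : y i ≠ x i)
    (hD : T a b * degreeDiff x G i + absentLLR a b n *
      (|(degreeDiff x G i : ℝ)| + |((∑ v, ((x v : ℤˣ) : ℤ) : ℤ) : ℝ)| + 1) ≤ noiseLLR α) :
    likelihood a b α x G y ≤ likelihood a b α (flipLabel x i) G y := by
  have ha : 0 < a := hb.trans_le hab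
  have hq : edgeProb b n < 1 := (edgeProb_mono hab).trans_lt hp
  have hl := absentLLR_nonneg hab hp
  rw [likelihood, likelihood, noiseProb_flipLabel h0 h1 hy, graphProb_eq_mul_exp hb ha hp hq x G i]
  have hg := graphProb_nonneg hb ha hp hq (flipLabel x i) G
  have hn := noiseProb_nonneg h0 h1 x y
  set D : ℝ := ((degreeDiff x G i : ℤ) : ℝ)
  set S : ℤ := ∑ v, ((x v : ℤˣ) : ℤ)
  have hS : -|(S : ℝ)| ≤ ((((x i : ℤˣ) : ℤ) * S : ℤ) : ℝ) := by
    rcases Int.units_eq_one_or (x i) with h | h <;> rw [h] <;> push_cast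
    · simpa using neg_abs_le (S : ℝ)
    · simpa using le_abs_self (S : ℝ)
  -- As `absentLLR` is nonnegative, the signed quantity multiplying it may be replaced by its worst
  -- case.
  have key : (T a b + absentLLR a b n) * D - absentLLR a b n * (((x i : ℤˣ) : ℤ) * S - 1 : ℤ)
      ≤ noiseLLR α := by
    refine le_trans ?_ hD
    have h3 : D - (((((x i : ℤˣ) : ℤ) * S - 1 : ℤ)) : ℝ) ≤ |D| + |(S : ℝ)| + 1 := by
      have := le_abs_self D
      push_cast at hS ⊢
      linarith
    have := mul_le_mul_of_nonneg_left h3 hl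
    linarith
  have key' := Real.exp_le_exp.2 key
  calc _ = (graphProb a b (flipLabel x i) G * noiseProb α x y) * Real.exp _ := by ring
    _ ≤ (graphProb a b (flipLabel x i) G * noiseProb α x y) * Real.exp (noiseLLR α) := by
        gcongr
    _ = _ := by ring

/-- The label vector with the labels of `i` and `j` exchanged. -/
def swapLabels (x : Labels n) (i j : Fin n) : Labels n := x ∘ Equiv.swap i j

theorem swapLabels_eq_flipLabel {x : Labels n} {i j : Fin n} (hi : x i = 1) (hj : x j = -1) :
    swapLabels x i j = flipLabel (flipLabel x i) j := by
  have hij : j ≠ i := by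
    rintro rfl
    rw [hi] at hj
    exact absurd hj (by decide)
  funext k
  simp only [swapLabels, Function.comp_apply, flipLabel, Equiv.swap_apply_def, Function.update_apply]
  split_ifs <;> simp_all

theorem sum_flipLabel (x : Labels n) (i : Fin n) :
    ∑ v, ((flipLabel x i v : ℤˣ) : ℤ) = ∑ v, ((x v : ℤˣ) : ℤ) - 2 * ((x i : ℤˣ) : ℤ) := by
  rw [← add_sum_erase univ _ (mem_univ i),
    ← add_sum_erase univ (fun v => ((x v : ℤˣ) : ℤ)) (mem_univ i), flipLabel_self]
  have : ∑ v ∈ univ.erase i, ((flipLabel x i v : ℤˣ) : ℤ) = ∑ v ∈ univ.erase i, ((x v : ℤˣ) : ℤ) :=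
    sum_congr rfl fun v hv => by rw [flipLabel_of_ne x (ne_of_mem_erase hv)]
  rw [this]
  push_cast
  ring

theorem degreeDiff_flipLabel {x : Labels n} {G : SimpleGraph (Fin n)} {i j : Fin n}
    (hij : j ≠ i) (hA : ¬ G.Adj j i) : degreeDiff (flipLabel x i) G j = degreeDiff x G j := by
  classical
  refine sum_congr rfl fun v hv => ?_
  have hv' : v ≠ i := by
    rintro rfl
    exact hA (mem_filter.1 hv).2
  rw [flipLabel_of_ne x hij, flipLabel_of_ne x hv']

/-- Exchanging the labels of `i` and `j` does not decrease the likelihood if both noisy labels are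
wrong, `i` and `j` are not adjacent, and neither has too many neighbours of its own kind. -/
theorem likelihood_le_likelihood_swapLabels (hb : 0 < b) (hab : b ≤ a) (hp : edgeProb a n < 1)
    {α : ℝ} (h0 : 0 < α) (h1 : α < 1 / 2)
    {x y : Labels n} {G : SimpleGraph (Fin n)} {i j : Fin n} (hi : x i = 1) (hj : x j = -1)
    (hyi : y i ≠ x i) (hyj : y j ≠ x j) (hA : ¬ G.Adj j i) {D : ℤ} (hDi : degreeDiff x G i = D)
    (hDj : degreeDiff x G j = D)
    (hD : T a b * D + absentLLR a b n *
      (|(D : ℝ)| + |((∑ v, ((x v : ℤˣ) : ℤ) : ℤ) : ℝ)| + 3) ≤ noiseLLR α) :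
    likelihood a b α x G y ≤ likelihood a b α (swapLabels x i j) G y := by
  have hij : j ≠ i := by
    rintro rfl
    rw [hi] at hj
    exact absurd hj (by decide)
  have hl := absentLLR_nonneg hab hp
  rw [swapLabels_eq_flipLabel hi hj]
  refine (likelihood_le_likelihood_flipLabel hb hab hp h0 h1 hyi ?_).trans
    (likelihood_le_likelihood_flipLabel hb hab hp h0 h1 (by rwa [flipLabel_of_ne x hij]) ?_)
  · rw [hDi]
    refine le_trans ?_ hD
    gcongr
    norm_num
  -- Non-adjacency keeps the degree difference of `j` unchanged by the flip of `i`. The label sum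
  -- moves by `2`, which is why `hD` has `3` instead of `1`.
  · rw [degreeDiff_flipLabel hij hA, hDj, sum_flipLabel, hi]
    refine le_trans ?_ hD
    have : |((∑ v, ((x v : ℤˣ) : ℤ) - 2 * ((1 : ℤˣ) : ℤ) : ℤ) : ℝ)|
        ≤ |((∑ v, ((x v : ℤˣ) : ℤ) : ℤ) : ℝ)| + 2 := by
      push_cast
      refine (abs_sub _ _).trans ?_
      norm_num
    have h3 := mul_le_mul_of_nonneg_left this hl
    linarith

end

end NoisySBM

/-! ### Failure of every estimator from competing labels; nearly balanced label vectors -/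

namespace NoisySBM

open Finset

theorem swapLabels_ne {n : ℕ} {x : Labels n} {i j : Fin n} (hi : x i = 1) (hj : x j = -1) :
    swapLabels x i j ≠ x := by
  intro h
  have := congrFun h i
  simp [swapLabels, hi, hj] at this

theorem swapLabels_mem_balancedLabels {n : ℕ} {x : Labels n} (hx : x ∈ balancedLabels n)
    (i j : Fin n) : swapLabels x i j ∈ balancedLabels n := by
  have key : ∀ s : ℤˣ, #{k | swapLabels x i j k = s} = #{k | x k = s} := fun s =>
    card_equiv (Equiv.swap i j) fun k => by
      simp only [mem_filter, mem_univ, true_and]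
      rfl
  simp only [balancedLabels, mem_filter, mem_univ, true_and] at hx ⊢
  rw [key, key, hx]

open Classical in
/-- If with probability at least `d` some other label vector in `S` is at least as likely as the
true one, whenever the true one is in `S'`, then every estimator fails often. -/
theorem le_failureProb_of_forall_le {a b α d : ℝ} {n : ℕ} {S S' : Finset (Labels n)}
    (hL : ∀ x G y, 0 ≤ likelihood a b α (n := n) x G y) (hS' : S' ⊆ S) (hne : S.Nonempty)
    (hcard : #S ≤ 2 * #S') (hd : 0 ≤ d)
    (h : ∀ x ∈ S', d ≤ ∑ G : SimpleGraph (Fin n), ∑ y : Labels n,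
      if ∃ x' ∈ S, x' ≠ x ∧ likelihood a b α x G y ≤ likelihood a b α x' G y
        then likelihood a b α x G y else 0)
    (g : Estimator n) : d / 4 ≤ failureProb a b α S g := by
  have hpos : (0 : ℝ) < #S := by exact_mod_cast hne.card_pos
  have hcard' : (#S : ℝ) ≤ 2 * #S' := by exact_mod_cast hcard
  rw [failureProb, le_div_iff₀ hpos]
  set F : Labels n → SimpleGraph (Fin n) → Labels n → Prop := fun x G y =>
    ∃ x' ∈ S, x' ≠ x ∧ likelihood a b α x G y ≤ likelihood a b α x' G y with hF
  have h1 : #S' * d ≤ ∑ x ∈ S', ∑ G : SimpleGraph (Fin n), ∑ y : Labels n,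
      if F x G y then likelihood a b α x G y else 0 := by
    rw [← nsmul_eq_mul]
    exact card_nsmul_le_sum _ _ _ h
  have h2 : ∑ x ∈ S', ∑ G : SimpleGraph (Fin n), ∑ y : Labels n,
      (if F x G y then likelihood a b α x G y else 0)
      ≤ 2 * ∑ x ∈ S, ∑ G : SimpleGraph (Fin n), ∑ y : Labels n,
        if g G y ≠ x then likelihood a b α x G y else 0 := by
    rw [sum_comm, sum_comm (s := S), mul_sum]
    refine sum_le_sum fun G _ => ?_
    rw [sum_comm, sum_comm (s := S), mul_sum]
    refine sum_le_sum fun y _ => ?_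
    have hnn : ∀ x ∈ S, 0 ≤ if g G y ≠ x then likelihood a b α x G y else 0 := fun x _ => by
      split_ifs <;> simp [hL]
    -- For fixed `(G, y)` at most one `x` is returned by `g`. If that `x` has a competitor `x'`,
    -- then `g` errs at `x'`, whose likelihood is at least as large. So the error terms over `S`,
    -- counted twice, dominate all `x` with competitors.
    have h3 : ∀ x ∈ S', (if F x G y then likelihood a b α x G y else 0)
        ≤ (if g G y ≠ x then likelihood a b α x G y else 0)
          + if g G y = x then
              ∑ x ∈ S, (if g G y ≠ x then likelihood a b α x G y else 0) else 0 := by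
      intro x hx
      by_cases hg : g G y = x
      · by_cases hFx : F x G y
        · obtain ⟨x', hx', hne', hle⟩ := hFx
          have h4 := single_le_sum hnn hx'
          rw [if_pos (by rw [hg]; exact hne'.symm)] at h4
          rw [if_pos ⟨x', hx', hne', hle⟩, if_neg (not_not.2 hg), if_pos hg, zero_add]
          exact hle.trans h4
        · rw [if_neg hFx, if_neg (not_not.2 hg), if_pos hg, zero_add]
          exact sum_nonneg hnn
      · rw [if_pos hg, if_neg hg, add_zero]
        split_ifs
        exacts [le_rfl, hL _ _ _]
    refine (sum_le_sum h3).trans ?_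
    rw [sum_add_distrib, two_mul]
    refine add_le_add (sum_le_sum_of_subset_of_nonneg hS' fun x hx _ => hnn x hx) ?_
    rw [sum_ite_eq]
    split_ifs
    exacts [le_rfl, sum_nonneg hnn]
  nlinarith

/-- The label vectors whose two communities differ in size by at most `√(2 n)`. -/
def nearlyBalanced (n : ℕ) : Finset (Labels n) :=
  {x : Labels n | (∑ v, ((x v : ℤˣ) : ℤ)) ^ 2 ≤ 2 * n}

/-- Negating the label of `i` permutes the label vectors and reverses the sign of the summand. -/
theorem sum_labels_mul_eq_zero {n : ℕ} {i j : Fin n} (h : i ≠ j) :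
    ∑ x : Labels n, ((x i : ℤˣ) : ℤ) * ((x j : ℤˣ) : ℤ) = 0 := by
  have hinv : Function.Involutive (fun x : Labels n => flipLabel x i) := by
    intro x
    simp [flipLabel]
  have := Equiv.sum_comp hinv.toPerm (fun x : Labels n => ((x i : ℤˣ) : ℤ) * ((x j : ℤˣ) : ℤ))
  simp only [Function.Involutive.coe_toPerm, flipLabel_self, flipLabel_of_ne _ h.symm, Units.val_neg,
    neg_mul, sum_neg_distrib] at this
  linarith

theorem sum_labels_sq (n : ℕ) :
    ∑ x : Labels n, (∑ v, ((x v : ℤˣ) : ℤ)) ^ 2 = n * Fintype.card (Labels n) := by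
  have h1 : ∀ x : Labels n, (∑ v, ((x v : ℤˣ) : ℤ)) ^ 2
      = ∑ i, ∑ j, ((x i : ℤˣ) : ℤ) * ((x j : ℤˣ) : ℤ) := fun x => by
    rw [sq, sum_mul_sum]
  simp_rw [h1]
  rw [sum_comm]
  have h2 : ∀ i : Fin n, ∑ x : Labels n, ∑ j, ((x i : ℤˣ) : ℤ) * ((x j : ℤˣ) : ℤ)
      = Fintype.card (Labels n) := by
    intro i
    rw [sum_comm, sum_eq_single i (fun j _ hj => sum_labels_mul_eq_zero hj.symm) (by simp)]
    have : ∀ x : Labels n, ((x i : ℤˣ) : ℤ) * ((x i : ℤˣ) : ℤ) = 1 := fun x => by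
      rw [← Units.val_mul, Int.units_mul_self, Units.val_one]
    simp [this]
  simp [h2]

/-- Chebyshev: the label sum has second moment `n`, so its square exceeds `2n` for at most half of
the vectors. -/
theorem card_allLabels_le (n : ℕ) : #(allLabels n) ≤ 2 * #(nearlyBalanced n) := by
  rcases n.eq_zero_or_pos with rfl | hn
  · simp [allLabels, nearlyBalanced]
  by_contra! hlt
  have h1 : #(nearlyBalanced n) + #(nearlyBalanced n)ᶜ = #(allLabels n) := by
    rw [card_add_card_compl]
    rfl
  have h2 : (#(nearlyBalanced n)ᶜ : ℤ) * (2 * n)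
      ≤ ∑ x : Labels n, (∑ v, ((x v : ℤˣ) : ℤ)) ^ 2 := by
    refine le_trans ?_ (sum_le_sum_of_subset_of_nonneg (subset_univ (nearlyBalanced n)ᶜ)
      fun x _ _ => sq_nonneg _)
    rw [← nsmul_eq_mul]
    refine card_nsmul_le_sum _ _ _ fun x hx => ?_
    simp only [nearlyBalanced, compl_filter, mem_filter, mem_univ, true_and, not_le] at hx
    exact hx.le
  rw [sum_labels_sq] at h2
  have h3 : Fintype.card (Labels n) = #(allLabels n) := rfl
  rw [h3] at h2
  have h4 : (n : ℤ) * (2 * #(nearlyBalanced n)ᶜ) ≤ n * #(allLabels n) := by linarith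
  have h5 := le_of_mul_le_mul_left h4 (by exact_mod_cast hn)
  omega

theorem sum_labels_eq {n : ℕ} (x : Labels n) :
    ∑ v, ((x v : ℤˣ) : ℤ) = #{v | x v = 1} - #{v | x v = -1} := by
  have : ∀ v, ((x v : ℤˣ) : ℤ) = (if x v = 1 then 1 else 0) - if x v = -1 then 1 else 0 := by
    intro v
    rcases Int.units_eq_one_or (x v) with h | h <;> rw [h] <;> simp
  simp_rw [this]
  rw [sum_sub_distrib]
  simp

theorem card_filter_add_card_filter {n : ℕ} (x : Labels n) :
    #{v | x v = 1} + #{v | x v = -1} = n := by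
  have := card_filter_add_card_filter_not (s := (univ : Finset (Fin n))) (fun v => x v = 1)
  rw [card_univ, Fintype.card_fin] at this
  convert this using 4 with v
  rcases Int.units_eq_one_or (x v) with h | h <;> rw [h] <;> simp

theorem balancedLabels_subset (n : ℕ) : balancedLabels n ⊆ nearlyBalanced n := by
  intro x hx
  simp only [balancedLabels, nearlyBalanced, mem_filter, mem_univ, true_and] at hx ⊢
  rw [sum_labels_eq, hx]
  simp

theorem balancedLabels_nonempty {n : ℕ} (hn : Even n) : (balancedLabels n).Nonempty := by
  obtain ⟨m, rfl⟩ := hn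
  obtain ⟨s, -, hs⟩ := exists_subset_card_eq (s := (univ : Finset (Fin (m + m)))) (n := m) (by simp)
  refine ⟨fun v => if v ∈ s then 1 else -1, ?_⟩
  have h1 := card_filter_add_card_filter (fun v : Fin (m + m) => if v ∈ s then (1 : ℤˣ) else -1)
  have h2 : #{v | (if v ∈ s then (1 : ℤˣ) else -1) = 1} = m := by
    refine Eq.trans (congrArg _ ?_) hs
    ext v
    by_cases h : v ∈ s <;> simp [h]
  simp only [balancedLabels, mem_filter, mem_univ, true_and]
  omega

end NoisySBM

/-! ### Independent coins and events decided by disjoint sets of coins -/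

namespace NoisySBM

open Finset MeasureTheory ProbabilityTheory

/-- The law of a coin showing `true` with probability `p`. -/
noncomputable def coin (p : unitInterval) : Measure Bool :=
  ENNReal.ofReal p • Measure.dirac true + ENNReal.ofReal (1 - p) • Measure.dirac false

instance (p : unitInterval) : IsProbabilityMeasure (coin p) where
  measure_univ := by
    simp only [coin, Measure.coe_add, Measure.coe_smul, Pi.add_apply, Pi.smul_apply, measure_univ,
      smul_eq_mul, mul_one]
    rw [← ENNReal.ofReal_add p.2.1 (by linarith [p.2.2])]
    simp

theorem coin_real_singleton (p : unitInterval) (c : Bool) :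
    (coin p).real {c} = if c then (p : ℝ) else 1 - p := by
  have h1 := p.2.1
  have h2 := p.2.2
  cases c <;> simp [Measure.real, coin, h1, h2]

section

variable {ι : Type*} [Fintype ι] [DecidableEq ι] {pr : ι → unitInterval}

/-- The law of independent coins with success probabilities `pr`. -/
noncomputable def coins (pr : ι → unitInterval) : Measure (ι → Bool) :=
  Measure.pi fun k => coin (pr k)

instance : IsProbabilityMeasure (coins pr) := by
  unfold coins
  infer_instance

theorem coins_real_cylinder (S : Finset ι) (f : ι → Bool) :
    (coins pr).real {ω | ∀ k ∈ S, ω k = f k}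
      = ∏ k ∈ S, if f k then (pr k : ℝ) else 1 - pr k := by
  have h1 : {ω : ι → Bool | ∀ k ∈ S, ω k = f k}
      = Set.univ.pi fun k => if k ∈ S then {f k} else Set.univ := by
    ext ω
    simp only [Set.mem_ofPred_eq, Set.mem_pi, Set.mem_univ, true_implies]
    refine forall_congr' fun k => ?_
    split_ifs with h <;> simp [h]
  rw [h1, Measure.real, coins, Measure.pi_pi, ENNReal.toReal_prod]
  rw [← prod_subset (subset_univ S)]
  · refine prod_congr rfl fun k hk => ?_
    rw [if_pos hk, ← coin_real_singleton, Measure.real]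
  · intro k _ hk
    rw [if_neg hk, measure_univ, ENNReal.toReal_one]

end

/-- Membership in `A` is decided by the coins in `S`. -/
def DeterminedBy {ι : Type*} (A : Set (ι → Bool)) (S : Finset ι) : Prop :=
  ∀ ⦃ω ω' : ι → Bool⦄, (∀ k ∈ S, ω k = ω' k) → ω ∈ A → ω' ∈ A

namespace DeterminedBy

variable {ι : Type*} {A B : Set (ι → Bool)} {S S' : Finset ι}

theorem mono (h : DeterminedBy A S) (hS : S ⊆ S') : DeterminedBy A S' :=
  fun _ _ hω => h fun k hk => hω k (hS hk)

theorem compl (h : DeterminedBy A S) : DeterminedBy Aᶜ S :=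
  fun _ _ hω hA hA' => hA (h (fun k hk => (hω k hk).symm) hA')

theorem inter (hA : DeterminedBy A S) (hB : DeterminedBy B S) : DeterminedBy (A ∩ B) S :=
  fun _ _ hω h => ⟨hA hω h.1, hB hω h.2⟩

/-- Exhibits `A` as an event about the coordinates in `S`, the form in which independence of
disjoint blocks of coordinates applies. -/
theorem preimage_image (h : DeterminedBy A S) :
    (fun (ω : ι → Bool) (k : S) => ω k) ⁻¹' ((fun (ω : ι → Bool) (k : S) => ω k) '' A) = A := by
  refine Set.Subset.antisymm ?_ (Set.subset_preimage_image _ _)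
  rintro ω ⟨ω', h', he⟩
  exact h (fun k hk => congrFun he ⟨k, hk⟩) h'

end DeterminedBy

theorem determinedBy_card_eq {ι : Type*} (S : Finset ι) (m : ℕ) :
    DeterminedBy {ω : ι → Bool | #{k ∈ S | ω k = true} = m} S := by
  intro ω ω' hω h
  simp only [Set.mem_ofPred_eq] at h ⊢
  rw [← h]
  congr 1
  exact filter_congr fun k hk => by rw [hω k hk]

section

variable {ι : Type*} [Fintype ι] {pr : ι → unitInterval}

theorem iIndepFun_coins : iIndepFun (fun k (ω : ι → Bool) => ω k) (coins pr) := by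
  unfold coins
  exact iIndepFun_pi (X := fun _ => id) fun _ => aemeasurable_id

theorem coins_real_inter {A B : Set (ι → Bool)} {S S' : Finset ι} (hA : DeterminedBy A S)
    (hB : DeterminedBy B S') (hS : Disjoint S S') :
    (coins pr).real (A ∩ B) = (coins pr).real A * (coins pr).real B := by
  have h := (iIndepFun_coins (pr := pr)).indepFun_finset S S' hS fun k => measurable_pi_apply k
  have h' := h.measure_inter_preimage_eq_mul _ _
    (Set.toFinite ((fun (ω : ι → Bool) (k : S) => ω k) '' A)).measurableSet
    (Set.toFinite ((fun (ω : ι → Bool) (k : S') => ω k) '' B)).measurableSet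
  rw [hA.preimage_image, hB.preimage_image] at h'
  simp [Measure.real, h']

theorem coins_real_iInter {V : Type*} [DecidableEq V] {A : V → Set (ι → Bool)}
    {S : V → Finset ι} (H : Finset V) (hA : ∀ v ∈ H, DeterminedBy (A v) (S v))
    (hS : (H : Set V).PairwiseDisjoint S) :
    (coins pr).real (⋂ v ∈ H, A v) = ∏ v ∈ H, (coins pr).real (A v) := by
  classical
  induction H using Finset.induction_on with
  | empty => simp
  | insert v H hv ih =>
    rw [prod_insert hv, set_biInter_insert, coins_real_inter (S' := H.biUnion S)
      (hA v (mem_insert_self _ _)), ih (fun w hw => hA w (mem_insert_of_mem hw))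
        (hS.subset (by simp))]
    · intro ω ω' hω h
      simp only [Set.mem_iInter] at h ⊢
      exact fun w hw => hA w (mem_insert_of_mem hw) (fun k hk => hω k (mem_biUnion.2 ⟨w, hw, hk⟩))
        (h w hw)
    · rw [disjoint_biUnion_right]
      intro w hw
      exact hS (by simp) (by simp [hw]) (by rintro rfl; exact hv hw)

/-- The probability that none of many independent events, all of probability at least `π`,
happens. -/
theorem coins_real_iInter_compl_le {V : Type*} [DecidableEq V] {A : V → Set (ι → Bool)}
    {S : V → Finset ι} (H : Finset V) (hA : ∀ v ∈ H, DeterminedBy (A v) (S v))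
    (hS : (H : Set V).PairwiseDisjoint S) {π : ℝ} (hπ : ∀ v ∈ H, π ≤ (coins pr).real (A v)) :
    (coins pr).real (⋂ v ∈ H, (A v)ᶜ) ≤ Real.exp (-(#H * π)) := by
  rw [coins_real_iInter H (fun v hv => (hA v hv).compl) hS]
  have h1 : ∀ v ∈ H, (coins pr).real (A v)ᶜ ≤ Real.exp (-π) := fun v hv => by
    rw [probReal_compl_eq_one_sub (Set.toFinite _).measurableSet]
    have := Real.add_one_le_exp (-π)
    linarith [hπ v hv]
  refine (prod_le_prod (fun v _ => measureReal_nonneg) h1).trans ?_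
  rw [prod_const, ← Real.exp_nat_mul]
  simp

/-- If some `C t` happens, then with conditional probability at least `ρ` so does the
corresponding `B t`, when the `C t` and the `B t` are decided by different coins. -/
theorem le_coins_real_iUnion_inter {V : Type*} [DecidableEq V] {B C : V → Set (ι → Bool)}
    {S S' : Finset ι} (hS : Disjoint S S') (H : Finset V) (hC : ∀ t ∈ H, DeterminedBy (C t) S)
    (hB : ∀ t ∈ H, DeterminedBy (B t) S') {ρ : ℝ} (hρ : ∀ t ∈ H, ρ ≤ (coins pr).real (B t)) :
    ρ * (coins pr).real (⋃ t ∈ H, C t) ≤ (coins pr).real (⋃ t ∈ H, C t ∩ B t) := by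
  -- The extra event `D` records that the indices already treated failed: splitting according to the
  -- first `C t` that happens makes the pieces disjoint.
  suffices h : ∀ D, DeterminedBy D S →
      ρ * (coins pr).real (D ∩ ⋃ t ∈ H, C t) ≤ (coins pr).real (D ∩ ⋃ t ∈ H, C t ∩ B t) by
    simpa using h Set.univ fun _ _ _ _ => trivial
  induction H using Finset.induction_on with
  | empty => simp
  | insert t H ht ih =>
    intro D hD
    have hCt := hC t (mem_insert_self _ _)
    have ih' := ih (fun s hs => hC s (mem_insert_of_mem hs)) (fun s hs => hB s (mem_insert_of_mem hs))
      (fun s hs => hρ s (mem_insert_of_mem hs)) (D ∩ (C t)ᶜ) (hD.inter hCt.compl)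
    have h1 := coins_real_inter (pr := pr) (hD.inter hCt) (hB t (mem_insert_self _ _)) hS
    have h2 := mul_le_mul_of_nonneg_left (hρ t (mem_insert_self _ _))
      (measureReal_nonneg (μ := coins pr) (s := D ∩ C t))
    have h3 : (coins pr).real (D ∩ ⋃ s ∈ insert t H, C s)
        = (coins pr).real (D ∩ C t) + (coins pr).real (D ∩ (C t)ᶜ ∩ ⋃ s ∈ H, C s) := by
      rw [← measureReal_union _ (Set.toFinite _).measurableSet]
      · congr 1
        ext ω
        simp only [set_biUnion_insert, Set.mem_inter_iff, Set.mem_union, Set.mem_compl_iff]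
        tauto
      · refine Set.disjoint_left.2 fun ω h h' => h'.1.2 h.2
    have h4 : (coins pr).real (D ∩ C t ∩ B t)
        + (coins pr).real (D ∩ (C t)ᶜ ∩ ⋃ s ∈ H, C s ∩ B s)
        ≤ (coins pr).real (D ∩ ⋃ s ∈ insert t H, C s ∩ B s) := by
      rw [← measureReal_union _ (Set.toFinite _).measurableSet]
      · refine measureReal_mono ?_
        intro ω
        simp only [set_biUnion_insert, Set.mem_inter_iff, Set.mem_union, Set.mem_compl_iff]
        tauto
      · refine Set.disjoint_left.2 fun ω h h' => h'.1.2 h.1.2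
    rw [h3]
    linarith

/-- The number of successes among coins of the same kind has a binomial distribution. -/
theorem coins_real_card_eq (S : Finset ι) {p : ℝ} (hp : ∀ k ∈ S, (pr k : ℝ) = p) (m : ℕ) :
    (coins pr).real {ω | #{k ∈ S | ω k = true} = m}
      = (#S).choose m * p ^ m * (1 - p) ^ (#S - m) := by
  classical
  -- Disjoint decomposition according to the exact set `K` of successes.
  have h1 : {ω : ι → Bool | #{k ∈ S | ω k = true} = m}
      = ⋃ K ∈ powersetCard m S, {ω | ∀ k ∈ S, ω k = decide (k ∈ K)} := by
    ext ω
    simp only [Set.mem_ofPred_eq, Set.mem_iUnion, mem_powersetCard, exists_prop]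
    constructor
    · intro h
      exact ⟨_, ⟨filter_subset _ _, h⟩, fun k hk => by simp [hk]⟩
    · rintro ⟨K, ⟨hK, hm⟩, h⟩
      rw [← hm]
      congr 1
      ext k
      simp only [mem_filter]
      constructor
      · rintro ⟨hk, h'⟩
        simpa [h k hk] using h'
      · intro hk
        exact ⟨hK hk, by simp [h k (hK hk), hk]⟩
  rw [h1, measureReal_biUnion_finset _ fun _ _ => (Set.toFinite _).measurableSet]
  · rw [sum_congr rfl (g := fun _ => p ^ m * (1 - p) ^ (#S - m)), sum_const, card_powersetCard,
      nsmul_eq_mul, mul_assoc]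
    intro K hK
    rw [mem_powersetCard] at hK
    rw [coins_real_cylinder S fun k => decide (k ∈ K)]
    simp only [decide_eq_true_eq]
    rw [prod_congr rfl (g := fun k => if k ∈ K then p else 1 - p)
      (fun k hk => by rw [hp k hk]), prod_ite, prod_const, prod_const, filter_not, filter_mem_eq_inter,
      inter_eq_right.2 hK.1, card_sdiff_of_subset hK.1, hK.2]
  · intro K hK K' hK' hne
    refine Set.disjoint_left.2 fun ω h h' => hne ?_
    simp only [mem_coe, mem_powersetCard, Set.mem_ofPred_eq] at hK hK' h h'
    ext k
    constructor
    · intro hk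
      have := (h' k (hK.1 hk)).symm.trans (h k (hK.1 hk))
      simpa [hk] using this
    · intro hk
      have := (h k (hK'.1 hk)).symm.trans (h' k (hK'.1 hk))
      simpa [hk] using this

/-- A lower bound for the probability that a few coins show no success. -/
theorem le_coins_real_forall_false (S : Finset ι) {p : ℝ} (hp1 : p ≤ 1)
    (hp : ∀ k ∈ S, (pr k : ℝ) ≤ p) :
    1 - #S * p ≤ (coins pr).real {ω | ∀ k ∈ S, ω k = false} := by
  classical
  rw [coins_real_cylinder S fun _ => false]
  have h1 := one_add_mul_le_pow (a := -p) (by linarith) #S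
  have h2 : (1 - p) ^ #S ≤ ∏ k ∈ S, if false = true then (pr k : ℝ) else 1 - pr k := by
    rw [← prod_const]
    refine prod_le_prod (fun k _ => by linarith) fun k hk => ?_
    have := hp k hk
    simp only [Bool.false_eq_true, if_false]
    linarith
  refine le_trans ?_ h2
  rw [sub_eq_add_neg 1 p]
  linarith

end

end NoisySBM

/-! ### The model as a coin space -/

namespace NoisySBM

open Finset MeasureTheory ProbabilityTheory

section

variable {n : ℕ}

/-- The coins used to generate the graph and the noise: one for each pair of vertices (those for
`(u, v)` with `v ≤ u` are idle) and one for each vertex. -/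
abbrev CoinIndex (n : ℕ) : Type := (Fin n × Fin n) ⊕ Fin n

/-- The success probabilities of the coins, given the labels `x`. -/
def coinProb (p q α : unitInterval) (x : Labels n) : CoinIndex n → unitInterval
  | .inl e => if x e.1 = x e.2 then p else q
  | .inr _ => α

/-- The coin deciding whether `u` and `v` are adjacent. -/
def edgeCoin (u v : Fin n) : CoinIndex n := .inl (min u v, max u v)

theorem edgeCoin_comm (u v : Fin n) : edgeCoin u v = edgeCoin v u := by
  simp [edgeCoin, min_comm, max_comm]

theorem edgeCoin_eq_iff {u v s t : Fin n} :
    edgeCoin u v = edgeCoin s t ↔ (u = s ∧ v = t) ∨ (u = t ∧ v = s) := by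
  simp only [edgeCoin, Sum.inl.injEq, Prod.mk.injEq]
  constructor
  · rintro ⟨h1, h2⟩
    grind
  · rintro (⟨rfl, rfl⟩ | ⟨rfl, rfl⟩)
    · simp
    · exact ⟨min_comm _ _, max_comm _ _⟩

theorem edgeCoin_injective (u : Fin n) : Function.Injective (edgeCoin u) := by
  intro v w h
  rw [edgeCoin_eq_iff] at h
  grind

theorem coinProb_edgeCoin (p q α : unitInterval) (x : Labels n) (u v : Fin n) :
    coinProb p q α x (edgeCoin u v) = if x u = x v then p else q := by
  rcases le_total u v with h | h
  · simp [coinProb, edgeCoin, h]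
  · simp [coinProb, edgeCoin, h, eq_comm]

/-- The graph read off from the coins. -/
def coinGraph (ω : CoinIndex n → Bool) : SimpleGraph (Fin n) where
  Adj u v := u ≠ v ∧ ω (edgeCoin u v) = true
  symm := ⟨fun u v h => ⟨h.1.symm, by rw [edgeCoin_comm]; exact h.2⟩⟩
  loopless := ⟨fun _ h => h.1 rfl⟩

/-- The noisy labels read off from the coins, when the true labels are `x`. -/
def coinLabels (x : Labels n) (ω : CoinIndex n → Bool) : Labels n :=
  fun i => if ω (.inr i) = true then -x i else x i

theorem coinGraph_eq_iff (ω : CoinIndex n → Bool) (G : SimpleGraph (Fin n)) :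
    coinGraph ω = G ↔ ∀ e : Fin n × Fin n, e.1 < e.2 → (ω (.inl e) = true ↔ G.Adj e.1 e.2) := by
  constructor
  · rintro rfl ⟨u, v⟩ h
    dsimp only at h
    simp [coinGraph, edgeCoin, h.ne, h.le]
  · intro h
    have key : ∀ u v : Fin n, u < v → ((coinGraph ω).Adj u v ↔ G.Adj u v) := by
      intro u v huv
      rw [← h (u, v) huv]
      simp [coinGraph, edgeCoin, huv.ne, huv.le]
    ext u v
    rcases lt_trichotomy u v with huv | rfl | huv
    · exact key u v huv
    · simp
    · rw [SimpleGraph.adj_comm, G.adj_comm, key v u huv]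

theorem coinLabels_eq_iff (ω : CoinIndex n → Bool) (x y : Labels n) :
    coinLabels x ω = y ↔ ∀ i, (ω (.inr i) = true ↔ y i ≠ x i) := by
  rw [funext_iff]
  refine forall_congr' fun i => ?_
  unfold coinLabels
  split_ifs with h
  · rw [units_neg_eq_iff]
    simp [h, eq_comm]
  · simp [h, eq_comm]

/-- A prescribed `(G, y)` is a cylinder on the coins of pairs `u < v` and of vertices; the idle
coins are unconstrained. -/
theorem coins_real_eq_likelihood {a b α : ℝ} {p q r : unitInterval} (hp : (p : ℝ) = edgeProb a n)
    (hq : (q : ℝ) = edgeProb b n) (hr : (r : ℝ) = α) (x : Labels n) (G : SimpleGraph (Fin n))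
    (y : Labels n) :
    (coins (coinProb p q r x)).real {ω | coinGraph ω = G ∧ coinLabels x ω = y}
      = likelihood a b α x G y := by
  classical
  have h1 : {ω : CoinIndex n → Bool | coinGraph ω = G ∧ coinLabels x ω = y}
      = {ω | ∀ k ∈ (univ.filter fun e : Fin n × Fin n => e.1 < e.2).disjSum univ,
          ω k = Sum.elim (fun e => decide (G.Adj e.1 e.2)) (fun i => decide (y i ≠ x i)) k} := by
    ext ω
    simp only [Set.mem_ofPred_eq, coinGraph_eq_iff, coinLabels_eq_iff]
    constructor
    · rintro ⟨h1, h2⟩ (e | i) hk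
      · have := h1 e (by simpa using hk)
        simp [← this]
      · have := h2 i
        simp only [Sum.elim_inr, ← this]
        simp
    · intro h
      refine ⟨fun e he => ?_, fun i => ?_⟩
      · rw [h (.inl e) (by simpa using he)]
        simp
      · rw [h (.inr i) (by simp)]
        simp
  rw [h1, coins_real_cylinder, prod_disjSum, likelihood, graphProb, noiseProb]
  congr 1
  · refine prod_congr rfl fun e _ => ?_
    by_cases hx : x e.1 = x e.2 <;> by_cases hA : G.Adj e.1 e.2 <;> simp [coinProb, hx, hA, hp, hq]
  · refine prod_congr rfl fun i _ => ?_
    by_cases hy : y i = x i <;> simp [coinProb, hy, hr]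

open Classical in
theorem coins_real_eq_sum_likelihood {a b α : ℝ} {p q r : unitInterval}
    (hp : (p : ℝ) = edgeProb a n) (hq : (q : ℝ) = edgeProb b n) (hr : (r : ℝ) = α) (x : Labels n)
    (F : SimpleGraph (Fin n) → Labels n → Prop) :
    (coins (coinProb p q r x)).real {ω | F (coinGraph ω) (coinLabels x ω)}
      = ∑ G : SimpleGraph (Fin n), ∑ y : Labels n, if F G y then likelihood a b α x G y else 0 := by
  rw [← sum_product', ← sum_filter, univ_product_univ]
  rw [← sum_congr rfl fun Gy _ => coins_real_eq_likelihood hp hq hr x Gy.1 Gy.2]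
  have h1 : {ω : CoinIndex n → Bool | F (coinGraph ω) (coinLabels x ω)}
      = ⋃ Gy ∈ univ.filter (fun Gy : SimpleGraph (Fin n) × Labels n => F Gy.1 Gy.2),
          {ω | coinGraph ω = Gy.1 ∧ coinLabels x ω = Gy.2} := by
    ext ω
    simp
  rw [h1, measureReal_biUnion_finset _ fun _ _ => (Set.toFinite _).measurableSet]
  intro Gy _ Gy' _ hne
  refine Set.disjoint_left.2 fun ω h h' => hne ?_
  exact Prod.ext (h.1.symm.trans h'.1) (h.2.symm.trans h'.2)

end

end NoisySBM

/-! ### Existence of a misled pair -/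

namespace NoisySBM

open Finset MeasureTheory ProbabilityTheory

section

variable {n : ℕ}

/-- The coins for the pairs of `i` and a vertex outside `H` with the label of `i`. -/
def sameCoins (x : Labels n) (H : Finset (Fin n)) (i : Fin n) : Finset (CoinIndex n) :=
  (univ.filter fun v => v ∉ H ∧ x v = x i).image (edgeCoin i)

/-- The coins for the pairs of `i` and a vertex outside `H` with the other label. -/
def crossCoins (x : Labels n) (H : Finset (Fin n)) (i : Fin n) : Finset (CoinIndex n) :=
  (univ.filter fun v => v ∉ H ∧ x v ≠ x i).image (edgeCoin i)

/-- The coins for the pairs of `i` and a vertex outside `H`, and for the noisy label of `i`. -/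
def outerCoins (x : Labels n) (H : Finset (Fin n)) (i : Fin n) : Finset (CoinIndex n) :=
  sameCoins x H i ∪ (crossCoins x H i ∪ {.inr i})

/-- The event that the noisy label of `i` is wrong and that `i` has `k` neighbours with its own
label and `l` neighbours with the other label outside `H`. -/
def misleading (x : Labels n) (H : Finset (Fin n)) (k l : ℕ) (i : Fin n) :
    Set (CoinIndex n → Bool) :=
  {ω | #{c ∈ sameCoins x H i | ω c = true} = k} ∩
    ({ω | #{c ∈ crossCoins x H i | ω c = true} = l} ∩ {ω | ω (.inr i) = true})

theorem determinedBy_inr (i : Fin n) :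
    DeterminedBy {ω : CoinIndex n → Bool | ω (.inr i) = true} {.inr i} := by
  intro ω ω' hω h
  simp only [Set.mem_ofPred_eq] at h ⊢
  rw [← hω (.inr i) (by simp), h]

theorem determinedBy_misleading (x : Labels n) (H : Finset (Fin n)) (k l : ℕ) (i : Fin n) :
    DeterminedBy (misleading x H k l i) (outerCoins x H i) :=
  ((determinedBy_card_eq _ k).mono subset_union_left).inter
    (((determinedBy_card_eq _ l).mono
      (subset_union_left.trans subset_union_right)).inter
      ((determinedBy_inr i).mono (subset_union_right.trans subset_union_right)))

theorem disjoint_sameCoins_crossCoins (x : Labels n) (H : Finset (Fin n)) (i : Fin n) :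
    Disjoint (sameCoins x H i) (crossCoins x H i) := by
  rw [sameCoins, crossCoins, disjoint_image (edgeCoin_injective i), disjoint_left]
  intro v hv hv'
  simp only [mem_filter, mem_univ, true_and] at hv hv'
  exact hv'.2 hv.2

theorem mem_outerCoins_iff {x : Labels n} {H : Finset (Fin n)} {i : Fin n} {c : CoinIndex n} :
    c ∈ outerCoins x H i ↔ (∃ v, v ∉ H ∧ edgeCoin i v = c) ∨ c = .inr i := by
  simp only [outerCoins, sameCoins, crossCoins, mem_union, mem_image, mem_filter, mem_univ,
    true_and, mem_singleton]
  constructor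
  · rintro (⟨v, ⟨hv, -⟩, rfl⟩ | ⟨v, ⟨hv, -⟩, rfl⟩ | rfl)
    · exact .inl ⟨v, hv, rfl⟩
    · exact .inl ⟨v, hv, rfl⟩
    · exact .inr rfl
  · rintro (⟨v, hv, rfl⟩ | rfl)
    · by_cases h : x v = x i
      · exact .inl ⟨v, ⟨hv, h⟩, rfl⟩
      · exact .inr (.inl ⟨v, ⟨hv, h⟩, rfl⟩)
    · exact .inr (.inr rfl)

/-- Each pair counted has exactly one end in `H`, so it belongs to a single vertex of `H`. This is
why neighbours inside `H` are left out. -/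
theorem pairwiseDisjoint_outerCoins (x : Labels n) (H : Finset (Fin n)) :
    (H : Set (Fin n)).PairwiseDisjoint (outerCoins x H) := by
  intro i hi j hj hij
  refine disjoint_left.2 fun c hc hc' => ?_
  rw [mem_outerCoins_iff] at hc hc'
  rcases hc with ⟨v, hv, rfl⟩ | rfl <;> rcases hc' with ⟨w, hw, h⟩ | h
  · rw [edgeCoin_eq_iff] at h
    rcases h with ⟨rfl, -⟩ | ⟨rfl, -⟩
    · exact hij rfl
    · exact hv hj
  · cases h
  · cases h
  · exact hij (Sum.inr.inj h)

theorem disjoint_outerCoins_image (x : Labels n) (H : Finset (Fin n)) {i j : Fin n}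
    (hj : j ∈ H) : Disjoint (outerCoins x H i) (H.image (edgeCoin j)) := by
  refine disjoint_left.2 fun c hc hc' => ?_
  rw [mem_outerCoins_iff] at hc
  rw [mem_image] at hc'
  obtain ⟨w, hw, rfl⟩ := hc'
  rcases hc with ⟨v, hv, h⟩ | h
  · rw [edgeCoin_eq_iff] at h
    rcases h with ⟨-, rfl⟩ | ⟨-, rfl⟩
    exacts [hv hw, hv hj]
  · cases h

/-- The event that neither `i` nor `j` has a neighbour in `H`. -/
def isolatedIn (H : Finset (Fin n)) (i j : Fin n) : Set (CoinIndex n → Bool) :=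
  {ω | ∀ c ∈ H.image (edgeCoin i) ∪ H.image (edgeCoin j), ω c = false}

theorem degreeDiff_coinGraph {x : Labels n} {H : Finset (Fin n)} {k l : ℕ} {i : Fin n}
    (hi : i ∈ H) {ω : CoinIndex n → Bool} (hω : ω ∈ misleading x H k l i)
    (hH : ∀ v ∈ H, ω (edgeCoin i v) = false) : degreeDiff x (coinGraph ω) i = (k : ℤ) - l := by
  classical
  -- Without neighbours in `H`, the counts outside `H` are the full degrees.
  have h1 : ∀ v, (coinGraph ω).Adj i v ↔ v ∉ H ∧ ω (edgeCoin i v) = true := by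
    intro v
    constructor
    · intro h
      exact ⟨fun hv => by simpa [hH v hv] using h.2, h.2⟩
    · rintro ⟨hv, h⟩
      exact ⟨fun h' => hv (h' ▸ hi), h⟩
  obtain ⟨hk, hl, -⟩ := hω
  simp only [Set.mem_ofPred_eq, sameCoins, crossCoins, filter_image,
    card_image_of_injective _ (edgeCoin_injective i)] at hk hl
  rw [degreeDiff, ← hk, ← hl]
  have h2 : ∀ v, ((x i * x v : ℤˣ) : ℤ) = (if x v = x i then 1 else 0) - if x v ≠ x i then 1 else 0 := by
    intro v
    rw [units_mul_eq_ite]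
    by_cases h : x v = x i
    · simp [h]
    · simp [h, Ne.symm h]
  simp_rw [h2]
  rw [sum_sub_distrib, ← sum_filter, ← sum_filter, filter_filter, filter_filter, sum_const,
    sum_const]
  simp only [nsmul_eq_mul, mul_one]
  congr 3
  · ext v
    simp only [mem_filter, mem_univ, true_and, h1]
    tauto
  · ext v
    simp only [mem_filter, mem_univ, true_and, h1]
    tauto

theorem coins_real_misleading {p q r : unitInterval} (x : Labels n) (H : Finset (Fin n)) (k l : ℕ)
    (i : Fin n) :
    (coins (coinProb p q r x)).real (misleading x H k l i)
      = ((#{v | v ∉ H ∧ x v = x i}).choose k * (p : ℝ) ^ k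
          * (1 - p) ^ (#{v | v ∉ H ∧ x v = x i} - k))
        * (((#{v | v ∉ H ∧ x v ≠ x i}).choose l * (q : ℝ) ^ l
          * (1 - q) ^ (#{v | v ∉ H ∧ x v ≠ x i} - l)) * r) := by
  have hd : Disjoint (sameCoins x H i) (crossCoins x H i ∪ {.inr i}) := by
    rw [disjoint_union_right]
    refine ⟨disjoint_sameCoins_crossCoins x H i, ?_⟩
    simp [sameCoins, edgeCoin]
  have hd' : Disjoint (crossCoins x H i) {.inr i} := by
    simp [crossCoins, edgeCoin]
  rw [misleading, coins_real_inter (determinedBy_card_eq _ k)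
    (((determinedBy_card_eq _ l).mono subset_union_left).inter
      ((determinedBy_inr i).mono subset_union_right)) hd,
    coins_real_inter (determinedBy_card_eq _ l) (determinedBy_inr i) hd',
    coins_real_card_eq (p := (p : ℝ)) _ ?_, coins_real_card_eq (p := (q : ℝ)) _ ?_]
  · have h1 : {ω : CoinIndex n → Bool | ω (.inr i) = true}
        = {ω | ∀ c ∈ ({.inr i} : Finset (CoinIndex n)), ω c = (fun _ => true) c} := by
      simp
    rw [h1, coins_real_cylinder]
    simp [sameCoins, crossCoins, card_image_of_injective _ (edgeCoin_injective i), coinProb]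
  · simp only [crossCoins, mem_image, mem_filter, mem_univ, true_and]
    rintro _ ⟨v, ⟨-, hv⟩, rfl⟩
    rw [coinProb_edgeCoin, if_neg (Ne.symm hv)]
  · simp only [sameCoins, mem_image, mem_filter, mem_univ, true_and]
    rintro _ ⟨v, ⟨-, hv⟩, rfl⟩
    rw [coinProb_edgeCoin, if_pos hv.symm]

/-- With probability bounded away from zero there are a vertex of each community, not adjacent to
each other, whose noisy labels are wrong and which have `k - l` more neighbours of their own kind
than of the other kind. -/
theorem le_coins_real_exists_swap {p q r : unitInterval} (hqp : (q : ℝ) ≤ p) {x : Labels n}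
    {H₁ H₂ : Finset (Fin n)} {k l : ℕ} {π : ℝ} {h : ℕ} (hc1 : #H₁ = h) (hc2 : #H₂ = h)
    (hp : 4 * h * (p : ℝ) ≤ 1 / 2)
    (hπ : ∀ i ∈ H₁ ∪ H₂, π ≤ (coins (coinProb p q r x)).real (misleading x (H₁ ∪ H₂) k l i))
    (hh : 2 ≤ h * π) :
    1 / 4 ≤ (coins (coinProb p q r x)).real {ω | ∃ i ∈ H₁, ∃ j ∈ H₂,
      coinLabels x ω i ≠ x i ∧ coinLabels x ω j ≠ x j ∧ ¬ (coinGraph ω).Adj j i ∧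
      degreeDiff x (coinGraph ω) i = (k : ℤ) - l ∧ degreeDiff x (coinGraph ω) j = (k : ℤ) - l} := by
  set H := H₁ ∪ H₂ with hH
  set μ := coins (coinProb p q r x) with hμ
  set A := misleading x H k l with hA
  have hcH : #H ≤ 2 * h := (card_union_le _ _).trans (by omega)
  -- From `e ≥ 2`, so `exp (-2) ≤ 1/4`.
  have hexp : Real.exp (-(h * π)) ≤ 1 / 4 := by
    have h1 := Real.add_one_le_exp (1 : ℝ)
    have h2 : Real.exp (-(h * π)) ≤ Real.exp (-2) := Real.exp_le_exp.2 (by linarith)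
    refine h2.trans ?_
    rw [Real.exp_neg, show (2 : ℝ) = 1 + 1 by norm_num, Real.exp_add, one_div]
    refine inv_anti₀ (by norm_num) ?_
    nlinarith
  have hno : ∀ H' ⊆ H, #H' = h → μ.real (⋂ v ∈ H', (A v)ᶜ) ≤ 1 / 4 := by
    intro H' hH' hc
    refine le_trans ?_ hexp
    rw [← hc]
    exact coins_real_iInter_compl_le H' (fun v _ => determinedBy_misleading x H k l v)
      ((pairwiseDisjoint_outerCoins x H).subset (by exact_mod_cast hH'))
      fun v hv => hπ v (hH' hv)
  -- Union bound: each of `H₁`, `H₂` lacks a misled vertex with probability at most `1/4`.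
  have hU : 1 / 2 ≤ μ.real (⋃ t ∈ H₁ ×ˢ H₂, A t.1 ∩ A t.2) := by
    have h1 : (⋃ t ∈ H₁ ×ˢ H₂, A t.1 ∩ A t.2)ᶜ ⊆ (⋂ v ∈ H₁, (A v)ᶜ) ∪ ⋂ v ∈ H₂, (A v)ᶜ := by
      intro ω hω
      by_contra hcon
      simp only [Set.mem_union, Set.mem_iInter, Set.mem_compl_iff, not_or, not_forall, not_not] at hcon
      obtain ⟨⟨i, hi, hi'⟩, j, hj, hj'⟩ := hcon
      refine hω ?_
      simp only [Set.mem_iUnion, mem_product, exists_prop]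
      exact ⟨(i, j), ⟨hi, hj⟩, hi', hj'⟩
    have h2 := (measureReal_mono (μ := μ) h1).trans (measureReal_union_le _ _)
    rw [probReal_compl_eq_one_sub (Set.toFinite _).measurableSet] at h2
    linarith [hno H₁ subset_union_left hc1, hno H₂ subset_union_right hc2]
  -- At most `4h` coins, each successful with probability at most `p`, and `4hp ≤ 1/2`.
  have hB : ∀ t ∈ H₁ ×ˢ H₂, 1 / 2 ≤ μ.real (isolatedIn H t.1 t.2) := by
    rintro ⟨i, j⟩ -
    have h1 := le_coins_real_forall_false (pr := coinProb p q r x)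
      (H.image (edgeCoin i) ∪ H.image (edgeCoin j)) p.2.2 ?_
    · refine le_trans ?_ h1
      have h2 : #(H.image (edgeCoin i) ∪ H.image (edgeCoin j)) ≤ 4 * h := by
        refine (card_union_le _ _).trans ?_
        have := card_image_le (s := H) (f := edgeCoin i)
        have := card_image_le (s := H) (f := edgeCoin j)
        omega
      have h3 : ((#(H.image (edgeCoin i) ∪ H.image (edgeCoin j)) : ℕ) : ℝ) ≤ 4 * h := by
        exact_mod_cast h2
      have := mul_le_mul_of_nonneg_right h3 p.2.1
      linarith
    · intro c hc
      simp only [mem_union, mem_image] at hc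
      rcases hc with ⟨v, -, rfl⟩ | ⟨v, -, rfl⟩ <;> rw [coinProb_edgeCoin] <;> split_ifs
      exacts [le_rfl, hqp, le_rfl, hqp]
  -- Being misled depends on pairs leaving `H`, isolation on pairs inside `H`; the two sets of coins
  -- are disjoint.
  have key := le_coins_real_iUnion_inter (pr := coinProb p q r x)
    (C := fun t : Fin n × Fin n => A t.1 ∩ A t.2) (B := fun t => isolatedIn H t.1 t.2)
    (S := H.biUnion (outerCoins x H)) (S' := H.biUnion fun i => H.image (edgeCoin i))
    (by
      rw [disjoint_biUnion_left]
      intro i _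
      rw [disjoint_biUnion_right]
      exact fun j hj => disjoint_outerCoins_image x H hj)
    (H₁ ×ˢ H₂)
    (by
      intro t ht
      rw [mem_product] at ht
      exact ((determinedBy_misleading x H k l t.1).mono (subset_biUnion_of_mem _
          (mem_union_left _ ht.1))).inter ((determinedBy_misleading x H k l t.2).mono
            (subset_biUnion_of_mem _ (mem_union_right _ ht.2))))
    (by
      intro t ht ω ω' hω hmem c hc
      rw [mem_product] at ht
      rw [← hmem c hc, hω c]
      rcases mem_union.1 hc with hc | hc
      · exact mem_biUnion.2 ⟨t.1, mem_union_left _ ht.1, hc⟩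
      · exact mem_biUnion.2 ⟨t.2, mem_union_right _ ht.2, hc⟩)
    hB
  refine le_trans (le_trans ?_ key) (measureReal_mono ?_)
  · linarith
  · intro ω hω
    simp only [Set.mem_iUnion, mem_product, exists_prop] at hω
    obtain ⟨⟨i, j⟩, ⟨hi, hj⟩, ⟨hAi, hAj⟩, hiso⟩ := hω
    have hiH : i ∈ H := mem_union_left _ hi
    have hjH : j ∈ H := mem_union_right _ hj
    have hiso1 : ∀ v ∈ H, ω (edgeCoin i v) = false := fun v hv =>
      hiso _ (mem_union_left _ (mem_image_of_mem _ hv))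
    have hiso2 : ∀ v ∈ H, ω (edgeCoin j v) = false := fun v hv =>
      hiso _ (mem_union_right _ (mem_image_of_mem _ hv))
    have hlab : ∀ v, ω ∈ A v → coinLabels x ω v ≠ x v := by
      intro v hv
      have : ω (.inr v) = true := hv.2.2
      rw [coinLabels, if_pos this]
      exact units_neg_eq_iff.not.2 (by simp)
    refine ⟨i, hi, j, hj, hlab i hAi, hlab j hAj, fun h => ?_,
      degreeDiff_coinGraph hiH hAi hiso1, degreeDiff_coinGraph hjH hAj hiso2⟩
    have := h.2
    rw [hiso2 i hiH] at this
    cases this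

end

end NoisySBM

/-! ### Reduction to binomial probabilities -/

namespace NoisySBM

open Finset MeasureTheory ProbabilityTheory

/-- The probability that a binomial variable with parameters `m` and `p` equals `k`. -/
noncomputable def binomialWeight (p : ℝ) (m k : ℕ) : ℝ := m.choose k * p ^ k * (1 - p) ^ (m - k)

section

variable {n : ℕ}

theorem abs_sum_labels_le {x : Labels n} (hx : x ∈ nearlyBalanced n) :
    |((∑ v, ((x v : ℤˣ) : ℤ) : ℤ) : ℝ)| ≤ 2 * √n := by
  simp only [nearlyBalanced, mem_filter, mem_univ, true_and] at hx
  have h1 : ((∑ v, ((x v : ℤˣ) : ℤ) : ℤ) : ℝ) ^ 2 ≤ 2 * n := by exact_mod_cast hx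
  refine abs_le_of_sq_le_sq ?_ (by positivity)
  rw [mul_pow, Real.sq_sqrt (by positivity)]
  nlinarith [(n.cast_nonneg : (0 : ℝ) ≤ n)]

theorem abs_card_sub_le {x : Labels n} (hx : x ∈ nearlyBalanced n) (s : ℤˣ) :
    |(#{v | x v = s} : ℝ) - n / 2| ≤ √n := by
  have h1 := abs_sum_labels_le hx
  have h2 : (#{v | x v = 1} : ℝ) + #{v | x v = -1} = n := by
    exact_mod_cast card_filter_add_card_filter x
  rw [sum_labels_eq] at h1
  push_cast at h1
  rw [abs_le] at h1 ⊢
  rcases Int.units_eq_one_or s with rfl | rfl <;> constructor <;> linarith [h1.1, h1.2]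

theorem abs_card_notMem_sub_le {x : Labels n} (hx : x ∈ nearlyBalanced n) {H : Finset (Fin n)}
    {s : ℤˣ} {h : ℕ} (hH : #{v ∈ H | x v = s} = h) :
    |(#{v | v ∉ H ∧ x v = s} : ℝ) - n / 2| ≤ √n + h := by
  have h1 : #{v | v ∉ H ∧ x v = s} + h = #{v | x v = s} := by
    rw [← hH, ← card_filter_add_card_filter_not (s := univ.filter fun v => x v = s) (· ∈ H),
      add_comm, filter_filter, filter_filter]
    congr 2
    · ext v
      simp [and_comm]
    · ext v
      simp [and_comm]
  have h2 : (#{v | v ∉ H ∧ x v = s} : ℝ) + h = #{v | x v = s} := by exact_mod_cast h1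
  have h3 := abs_card_sub_le hx s
  rw [← h2] at h3
  rw [abs_le] at h3 ⊢
  have : (0 : ℝ) ≤ h := by positivity
  constructor <;> linarith [h3.1, h3.2]

open Classical in
-- The community sizes depend on `x`, so `hbin` is required uniformly over all sizes within `√n + h`
-- of `n / 2`.
theorem le_sum_likelihood_of_nearlyBalanced {a b α : ℝ} (hb : 0 < b) (hab : b ≤ a)
    (h0 : 0 < α) (h1 : α < 1 / 2) {h k l : ℕ} {π : ℝ} (hp : edgeProb a n < 1)
    (hhp : 4 * h * edgeProb a n ≤ 1 / 2) (hhn : h + √n ≤ n / 2) (hπ : 2 ≤ h * π)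
    (hbin : ∀ m₁ m₂ : ℕ, |(m₁ : ℝ) - n / 2| ≤ √n + h → |(m₂ : ℝ) - n / 2| ≤ √n + h →
      π ≤ binomialWeight (edgeProb a n) m₁ k * (binomialWeight (edgeProb b n) m₂ l * α))
    (hnum : T a b * (k - l : ℝ) + absentLLR a b n * (|(k - l : ℝ)| + 2 * √n + 3) ≤ noiseLLR α)
    {S : Finset (Labels n)} (hS : ∀ x ∈ S, ∀ i j, swapLabels x i j ∈ S)
    {x : Labels n} (hxS : x ∈ S) (hx : x ∈ nearlyBalanced n) :
    1 / 4 ≤ ∑ G : SimpleGraph (Fin n), ∑ y : Labels n,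
      if ∃ x' ∈ S, x' ≠ x ∧ likelihood a b α x G y ≤ likelihood a b α x' G y
        then likelihood a b α x G y else 0 := by
  have hq := edgeProb_mono (n := n) hab
  have hp0 := edgeProb_nonneg (hb.trans_le hab).le n
  have hq0 := edgeProb_nonneg hb.le n
  set p : unitInterval := ⟨edgeProb a n, hp0, hp.le⟩ with hpdef
  set q : unitInterval := ⟨edgeProb b n, hq0, hq.trans hp.le⟩ with hqdef
  set r : unitInterval := ⟨α, h0.le, by linarith⟩ with hrdef
  have heq := coins_real_eq_sum_likelihood (a := a) (b := b) (α := α) (p := p) (q := q) (r := r)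
    rfl rfl rfl x fun G y => ∃ x' ∈ S, x' ≠ x ∧ likelihood a b α x G y ≤ likelihood a b α x' G y
  refine le_of_le_of_eq ?_ (heq.trans (sum_congr rfl fun G _ => sum_congr rfl fun y _ => by congr))
  have hle : ∀ s : ℤˣ, h ≤ #{v | x v = s} := by
    intro s
    have := (abs_le.1 (abs_card_sub_le hx s)).1
    have h2 : (h : ℝ) ≤ #{v | x v = s} := by linarith
    exact_mod_cast h2
  obtain ⟨H₁, hH₁, hc1⟩ := exists_subset_card_eq (hle 1)
  obtain ⟨H₂, hH₂, hc2⟩ := exists_subset_card_eq (hle (-1))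
  have hx1 : ∀ v ∈ H₁, x v = 1 := fun v hv => (mem_filter.1 (hH₁ hv)).2
  have hx2 : ∀ v ∈ H₂, x v = -1 := fun v hv => (mem_filter.1 (hH₂ hv)).2
  -- Each community loses exactly `h` vertices to `H`.
  have hcard : ∀ s : ℤˣ, #{v ∈ H₁ ∪ H₂ | x v = s} = h := by
    intro s
    rcases Int.units_eq_one_or s with rfl | rfl
    · rw [← hc1]
      congr 1
      ext v
      simp only [mem_filter, mem_union]
      constructor
      · rintro ⟨hv | hv, h'⟩
        · exact hv
        · rw [hx2 v hv] at h'
          exact absurd h' (by decide)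
      · exact fun hv => ⟨.inl hv, hx1 v hv⟩
    · rw [← hc2]
      congr 1
      ext v
      simp only [mem_filter, mem_union]
      constructor
      · rintro ⟨hv | hv, h'⟩
        · rw [hx1 v hv] at h'
          exact absurd h' (by decide)
        · exact hv
      · exact fun hv => ⟨.inr hv, hx2 v hv⟩
  refine (le_coins_real_exists_swap (p := p) (q := q) (r := r) (x := x) (k := k) (l := l)
    hq hc1 hc2 hhp ?_ hπ).trans (measureReal_mono ?_)
  · intro i _
    rw [coins_real_misleading]
    refine hbin _ _ (abs_card_notMem_sub_le hx (hcard _)) ?_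
    simp only [units_ne_iff]
    exact abs_card_notMem_sub_le hx (hcard _)
  · rintro ω ⟨i, hi, j, hj, hyi, hyj, hA, hDi, hDj⟩
    refine ⟨swapLabels x i j, hS x hxS i j, swapLabels_ne (hx1 i hi) (hx2 j hj), ?_⟩
    refine likelihood_le_likelihood_swapLabels hb hab hp h0 h1 (hx1 i hi) (hx2 j hj) hyi hyj hA
      hDi hDj (le_trans ?_ hnum)
    have h3 := mul_le_mul_of_nonneg_left (abs_sum_labels_le hx) (absentLLR_nonneg hab hp)
    push_cast at h3 ⊢
    linarith

theorem failsAtLeast_of_le_binomialWeight {a b α : ℝ} (hb : 0 < b) (hab : b ≤ a)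
    (h0 : 0 < α) (h1 : α < 1 / 2) {h k l : ℕ} {π : ℝ} (hp : edgeProb a n < 1)
    (hhp : 4 * h * edgeProb a n ≤ 1 / 2) (hhn : h + √n ≤ n / 2) (hπ : 2 ≤ h * π)
    (hbin : ∀ m₁ m₂ : ℕ, |(m₁ : ℝ) - n / 2| ≤ √n + h → |(m₂ : ℝ) - n / 2| ≤ √n + h →
      π ≤ binomialWeight (edgeProb a n) m₁ k * (binomialWeight (edgeProb b n) m₂ l * α))
    (hnum : T a b * (k - l : ℝ) + absentLLR a b n * (|(k - l : ℝ)| + 2 * √n + 3) ≤ noiseLLR α) :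
    FailsAtLeast a b α (1 / 16) (allLabels n) ∧
      (Even n → FailsAtLeast a b α (1 / 16) (balancedLabels n)) := by
  have hL : ∀ x G y, 0 ≤ likelihood a b α (n := n) x G y :=
    likelihood_nonneg hb (hb.trans_le hab) hp ((edgeProb_mono hab).trans_lt hp) h0 h1
  have key : ∀ S S' : Finset (Labels n), S' ⊆ S → S' ⊆ nearlyBalanced n → S.Nonempty →
      #S ≤ 2 * #S' → (∀ x ∈ S, ∀ i j, swapLabels x i j ∈ S) →
      FailsAtLeast a b α (1 / 16) S := by
    intro S S' hSS hS' hne hc hS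
    have h3 : ∀ g, 1 / 16 ≤ failureProb a b α S g := fun g => by
      have := le_failureProb_of_forall_le hL hSS hne hc (by norm_num) (fun x hx =>
        le_sum_likelihood_of_nearlyBalanced hb hab h0 h1 hp hhp hhn hπ hbin hnum hS (hSS hx)
          (hS' hx)) g
      linarith
    exact ⟨fun g _ => h3 g, h3⟩
  -- The good set `S'` is `nearlyBalanced n` in the first model and all of `balancedLabels n` in the
  -- second.
  refine ⟨key _ (nearlyBalanced n) (subset_univ _) subset_rfl univ_nonempty (card_allLabels_le n)
    fun _ _ _ _ => mem_univ _, fun hn => key _ (balancedLabels n) subset_rfl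
      (balancedLabels_subset n) (balancedLabels_nonempty hn) (by omega)
      fun x hx i j => swapLabels_mem_balancedLabels hx i j⟩

end

end NoisySBM

/-! ### Large deviation lower bound for binomial weights -/

namespace NoisySBM

open Filter Topology

/-- The Stirling sequence decreases, so it is bounded by its value at `1`; `(log k) / 2` is weakened
to `log k`. -/
theorem log_factorial_le {k : ℕ} (hk : k ≠ 0) :
    Real.log (k.factorial : ℝ) ≤ 1 + Real.log k + k * Real.log k - k := by
  obtain ⟨j, rfl⟩ := Nat.exists_eq_succ_of_ne_zero hk
  have h1 := Stirling.log_stirlingSeq'_antitone (Nat.zero_le j)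
  simp only [Function.comp_apply] at h1
  rw [Stirling.log_stirlingSeq_formula, Stirling.log_stirlingSeq_formula] at h1
  have hpos : (0 : ℝ) < (j.succ : ℝ) := by positivity
  rw [Real.log_mul (by norm_num) hpos.ne', Real.log_div hpos.ne' (Real.exp_pos 1).ne', Real.log_exp]
    at h1
  have h2 : 0 ≤ Real.log (j.succ : ℝ) := Real.log_natCast_nonneg _
  have h3 : Real.log ((Nat.succ 0 : ℕ) : ℝ) = 0 := by simp
  simp at h1 h2 h3 ⊢
  linarith

/-- Combines `m.choose k ≥ (m + 1 - k) ^ k / k!`, the bound on `log k!` and `log (1 - p) ≥ -p / (1 -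
p)`, at the worst `m` within `w` of `c`. -/
theorem exp_le_binomialWeight {p w : ℝ} (hp0 : 0 < p) (hp1 : p < 1) {m k : ℕ} (hk : k ≠ 0) {c : ℝ}
    (hm : |(m : ℝ) - c| ≤ w) (hkw : k < c - w) :
    Real.exp (k * Real.log ((c - w - k) * p / k) - 1 - Real.log k + k - (c + w) * (p / (1 - p)))
      ≤ binomialWeight p m k := by
  rw [abs_le] at hm
  have hk0 : (0 : ℝ) < k := by positivity
  have hkm : (k : ℝ) < m := by linarith
  have hkm' : k ≤ m := by exact_mod_cast hkm.le
  have hcw : 0 < c - w - k := by linarith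
  have hq : 0 < 1 - p := by linarith
  have hbw : 0 < binomialWeight p m k := by
    have : 0 < m.choose k := Nat.choose_pos hkm'
    unfold binomialWeight
    positivity
  rw [← Real.le_log_iff_exp_le hbw, binomialWeight]
  have hch : (0 : ℝ) < m.choose k := by exact_mod_cast Nat.choose_pos hkm'
  rw [Real.log_mul (by positivity) (by positivity), Real.log_mul (by positivity) (by positivity),
    Real.log_pow, Real.log_pow, Real.log_div (by positivity) (by positivity),
    Real.log_mul hcw.ne' hp0.ne']
  have h1 : k * Real.log (c - w - k) - Real.log k.factorial ≤ Real.log (m.choose k) := by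
    have h2 : ((m + 1 - k : ℕ) ^ k : ℝ) / k.factorial ≤ m.choose k := Nat.pow_le_choose k m
    have h3 : c - w - k ≤ ((m + 1 - k : ℕ) : ℝ) := by
      rw [Nat.cast_sub (by omega)]
      push_cast
      linarith
    have h4 : (c - w - k) ^ k / k.factorial ≤ m.choose k := by
      refine le_trans ?_ h2
      gcongr
    have h5 := Real.log_le_log (by positivity) h4
    rwa [Real.log_div (by positivity) (by positivity), Real.log_pow] at h5
  have h6 := log_factorial_le hk
  have h7 : -((c + w) * (p / (1 - p))) ≤ ((m - k : ℕ) : ℝ) * Real.log (1 - p) := by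
    have h8 := Real.one_sub_inv_le_log_of_pos hq
    have h9 : 1 - (1 - p)⁻¹ = -(p / (1 - p)) := by
      field_simp
      ring
    rw [h9] at h8
    have h10 : ((m - k : ℕ) : ℝ) ≤ c + w := by
      rw [Nat.cast_sub hkm']
      linarith
    have h11 : 0 < p / (1 - p) := by positivity
    have h12 : (0 : ℝ) ≤ ((m - k : ℕ) : ℝ) := by positivity
    nlinarith
  linarith

/-- The large deviations rate: a binomial variable with parameters about `n / 2` and
`s * log n / n` is about `σ * log n` with probability `n ^ (-rate s σ + o(1))`. -/
noncomputable def rate (s σ : ℝ) : ℝ := s / 2 - σ + σ * Real.log (2 * σ / s)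

theorem tendsto_log_natCast : Tendsto (fun n : ℕ => Real.log n) atTop atTop :=
  Real.tendsto_log_atTop.comp tendsto_natCast_atTop_atTop

theorem tendsto_edgeProb (s : ℝ) : Tendsto (fun n : ℕ => edgeProb s n) atTop (𝓝 0) := by
  have h := (Real.isLittleO_log_id_atTop.tendsto_div_nhds_zero.comp
    (tendsto_natCast_atTop_atTop (R := ℝ))).const_mul s
  rw [mul_zero] at h
  refine h.congr fun n => ?_
  simp [edgeProb, mul_div_assoc]

theorem tendsto_floor_div_log {σ : ℝ} (hσ : 0 < σ) :
    Tendsto (fun n : ℕ => (⌊σ * Real.log n⌋₊ : ℝ) / Real.log n) atTop (𝓝 σ) :=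
  (tendsto_nat_floor_mul_div_atTop hσ.le).comp tendsto_log_natCast

theorem tendsto_floor_atTop {σ : ℝ} (hσ : 0 < σ) :
    Tendsto (fun n : ℕ => ⌊σ * Real.log n⌋₊) atTop atTop :=
  tendsto_nat_floor_atTop.comp (tendsto_log_natCast.const_mul_atTop hσ)

theorem tendsto_floor_div_self {σ : ℝ} (hσ : 0 < σ) :
    Tendsto (fun n : ℕ => (⌊σ * Real.log n⌋₊ : ℝ) / n) atTop (𝓝 0) := by
  have h := (tendsto_floor_div_log hσ).mul (tendsto_edgeProb 1)
  rw [mul_zero] at h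
  refine h.congr' ?_
  filter_upwards [tendsto_log_natCast.eventually_gt_atTop 0] with n hn
  rw [edgeProb]
  field_simp

theorem eventually_exp_le_binomialWeight {s σ ε : ℝ} (hs : 0 < s) (hσ : 0 < σ) (hε : 0 < ε)
    {w : ℕ → ℝ} (hw : Tendsto (fun n : ℕ => w n / n) atTop (𝓝 0)) :
    ∀ᶠ n : ℕ in atTop, ∀ m : ℕ, |(m : ℝ) - n / 2| ≤ w n →
      Real.exp (-((rate s σ + ε) * Real.log n))
        ≤ binomialWeight (edgeProb s n) m ⌊σ * Real.log n⌋₊ := by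
  have hL := tendsto_log_natCast
  have hp := tendsto_edgeProb s
  obtain ⟨k, hkdef⟩ : ∃ k : ℕ → ℕ, ∀ n, k n = ⌊σ * Real.log n⌋₊ := ⟨_, fun _ => rfl⟩
  have hk : Tendsto (fun n => (k n : ℝ) / Real.log n) atTop (𝓝 σ) := by
    simpa only [hkdef] using tendsto_floor_div_log hσ
  have hkn : Tendsto (fun n => (k n : ℝ) / n) atTop (𝓝 0) := by
    simpa only [hkdef] using tendsto_floor_div_self hσ
  have hkN : Tendsto k atTop atTop := (tendsto_floor_atTop hσ).congr fun n => (hkdef n).symm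
  have hkR : Tendsto (fun n => (k n : ℝ)) atTop atTop := tendsto_natCast_atTop_atTop.comp hkN
  have hlogk : Tendsto (fun n => Real.log (k n) / Real.log n) atTop (𝓝 0) := by
    have h := (Real.isLittleO_log_id_atTop.tendsto_div_nhds_zero.comp hkR).mul hk
    rw [zero_mul] at h
    refine h.congr' ?_
    filter_upwards [hkR.eventually_gt_atTop 0] with n hn
    simp only [Function.comp_apply, id]
    field_simp
  have hlo : Tendsto (fun n : ℕ => (n / 2 - w n - k n) / n) atTop (𝓝 (1 / 2)) := by
    have h := ((tendsto_const_nhds (x := (1 / 2 : ℝ))).sub hw).sub hkn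
    simp only [sub_zero] at h
    refine h.congr' ?_
    filter_upwards [eventually_gt_atTop 0] with n hn
    field_simp
  have hhi : Tendsto (fun n : ℕ => (n / 2 + w n) / n) atTop (𝓝 (1 / 2)) := by
    have h := (tendsto_const_nhds (x := (1 / 2 : ℝ))).add hw
    simp only [add_zero] at h
    refine h.congr' ?_
    filter_upwards [eventually_gt_atTop 0] with n hn
    field_simp
  -- The argument tends to `(1/2) * s / σ`, since `k n` is asymptotic to `σ log n`.
  have hlog : Tendsto (fun n : ℕ => Real.log ((n / 2 - w n - k n) * edgeProb s n / k n)) atTop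
      (𝓝 (-Real.log (2 * σ / s))) := by
    rw [← Real.log_inv]
    refine ((Real.continuousAt_log (by positivity)).tendsto).comp ?_
    have h := (hlo.mul_const s).div hk hσ.ne'
    have e : (1 / 2 * s / σ) = (2 * σ / s)⁻¹ := by field_simp
    rw [e] at h
    refine h.congr' ?_
    filter_upwards [hL.eventually_gt_atTop 0, hkR.eventually_gt_atTop 0] with n hn hn'
    rw [edgeProb]
    simp only [Pi.div_apply]
    field_simp
  -- Divided by `log n`, the exponent of `exp_le_binomialWeight` tends to `-rate s σ`; `ε` absorbs
  -- the error.
  have key : Tendsto (fun n : ℕ => (k n * Real.log ((n / 2 - w n - k n) * edgeProb s n / k n)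
      - 1 - Real.log (k n) + k n - (n / 2 + w n) * (edgeProb s n / (1 - edgeProb s n)))
        / Real.log n) atTop (𝓝 (-rate s σ)) := by
    have h1 := hhi.mul ((tendsto_const_nhds (x := s)).div
      ((tendsto_const_nhds (x := (1 : ℝ))).sub hp) (by norm_num))
    have h := ((((hk.mul hlog).sub (tendsto_inv_atTop_zero.comp hL)).sub hlogk).add hk).sub h1
    have e : σ * -Real.log (2 * σ / s) - 0 - 0 + σ - 1 / 2 * (s / (1 - 0)) = -rate s σ := by
      rw [rate]
      ring
    rw [e] at h
    refine h.congr' ?_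
    filter_upwards [hL.eventually_gt_atTop 0, eventually_gt_atTop 0, hp.eventually_lt_const one_pos]
      with n hn hn0 hp1
    have e2 : (n / 2 + w n) * (edgeProb s n / (1 - edgeProb s n)) / Real.log n
        = (n / 2 + w n) / n * (s / (1 - edgeProb s n)) := by
      have : edgeProb s n / Real.log n = s / n := by
        rw [edgeProb]
        field_simp
      calc _ = (n / 2 + w n) * (edgeProb s n / Real.log n) / (1 - edgeProb s n) := by ring
        _ = _ := by
          rw [this]
          ring
    simp only [Function.comp_apply]
    rw [sub_div, e2]
    congr 1
    field_simp
  filter_upwards [key.eventually_const_lt (show -(rate s σ + ε) < -rate s σ by linarith),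
    hL.eventually_gt_atTop 0, hp.eventually_lt_const one_pos, hkN.eventually_ge_atTop 1,
    hlo.eventually_const_lt (show (0 : ℝ) < 1 / 2 by norm_num), eventually_gt_atTop 0]
    with n hkey hL0 hp1 hk1 hlo0 hn0 m hm
  have hp0 : 0 < edgeProb s n := by
    unfold edgeProb
    positivity
  have hn0' : (0 : ℝ) < n := by exact_mod_cast hn0
  have hkw : (k n : ℝ) < n / 2 - w n := by
    have := (div_pos_iff_of_pos_right hn0').1 hlo0
    linarith
  rw [← hkdef]
  refine le_trans (Real.exp_le_exp.2 ?_) (exp_le_binomialWeight hp0 hp1 (by omega) hm hkw)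
  rw [lt_div_iff₀ hL0] at hkey
  linarith

end NoisySBM

/-! ### Asymptotics and the rate criterion -/

namespace NoisySBM

open Filter Topology

/-- `α = (1 - α) * exp (-c) ≥ exp (-c) / 2`, and the factor `2` is negligible against `n ^ ε`. -/
theorem eventually_exp_le_noise {α : ℕ → ℝ} (hα : ∀ n, 0 < α n ∧ α n < 1 / 2) {β ε : ℝ}
    (hε : 0 < ε) (hβ : Tendsto (fun n : ℕ => noiseLLR (α n) / Real.log n) atTop (𝓝 β)) :
    ∀ᶠ n : ℕ in atTop, Real.exp (-((β + ε) * Real.log n)) ≤ α n := by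
  have h := hβ.add ((tendsto_inv_atTop_zero.comp tendsto_log_natCast).mul_const (Real.log 2))
  rw [zero_mul, add_zero] at h
  filter_upwards [h.eventually_lt_const (show β < β + ε by linarith),
    tendsto_log_natCast.eventually_gt_atTop 0] with n hn hL
  obtain ⟨h0, h1⟩ := hα n
  have hn' : noiseLLR (α n) + Real.log 2 < (β + ε) * Real.log n := by
    rw [← div_lt_iff₀ hL]
    refine lt_of_eq_of_lt ?_ hn
    simp only [Function.comp_apply]
    ring
  rw [← Real.le_log_iff_exp_le h0]
  have h2 : noiseLLR (α n) = Real.log (1 - α n) - Real.log (α n) :=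
    Real.log_div (by linarith) h0.ne'
  have h3 : Real.log (1 / 2) ≤ Real.log (1 - α n) := Real.log_le_log (by norm_num) (by linarith)
  rw [one_div, Real.log_inv] at h3
  linarith

/-- The number of vertices of each community among which the misled ones are looked for. -/
noncomputable def sampleSize (a : ℝ) (n : ℕ) : ℕ := ⌊(n : ℝ) / (8 * a * Real.log n)⌋₊

/-- Accounts for the `8a` in `sampleSize`: the sample is small enough for the isolation step. -/
theorem four_mul_sampleSize_mul_le {a : ℝ} (ha : 0 < a) {n : ℕ} (hL : 0 < Real.log n) (hn : 0 < n) :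
    4 * (sampleSize a n : ℝ) * edgeProb a n ≤ 1 / 2 := by
  have h1 : (sampleSize a n : ℝ) ≤ n / (8 * a * Real.log n) := Nat.floor_le (by positivity)
  have hn' : (0 : ℝ) < n := by exact_mod_cast hn
  calc 4 * (sampleSize a n : ℝ) * edgeProb a n
      ≤ 4 * (n / (8 * a * Real.log n)) * edgeProb a n := by
        gcongr
        exact edgeProb_nonneg ha.le n
    _ = 1 / 2 := by
        rw [edgeProb]
        field_simp
        norm_num

theorem tendsto_sampleSize_div {a : ℝ} (ha : 0 < a) :
    Tendsto (fun n : ℕ => (sampleSize a n : ℝ) / n) atTop (𝓝 0) := by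
  have h : Tendsto (fun n : ℕ => (8 * a * Real.log n)⁻¹) atTop (𝓝 0) :=
    tendsto_inv_atTop_zero.comp (tendsto_log_natCast.const_mul_atTop (by positivity))
  refine squeeze_zero' (Eventually.of_forall fun n => by positivity) ?_ h
  filter_upwards [eventually_gt_atTop 0, tendsto_log_natCast.eventually_gt_atTop 0] with n hn hL
  have hn' : (0 : ℝ) < n := by exact_mod_cast hn
  rw [div_le_iff₀ hn', mul_comm, ← div_eq_mul_inv]
  exact Nat.floor_le (by positivity)

theorem tendsto_sqrt_div : Tendsto (fun n : ℕ => √(n : ℝ) / n) atTop (𝓝 0) := by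
  have h : Tendsto (fun n : ℕ => (√(n : ℝ))⁻¹) atTop (𝓝 0) :=
    tendsto_inv_atTop_zero.comp (Real.tendsto_sqrt_atTop.comp tendsto_natCast_atTop_atTop)
  refine h.congr fun n => ?_
  rw [Real.sqrt_div_self']
  simp

theorem eventually_two_le_sampleSize_mul {a ε : ℝ} (ha : 0 < a) (hε : 0 < ε) (hε1 : ε ≤ 1) :
    ∀ᶠ n : ℕ in atTop, 2 ≤ (sampleSize a n : ℝ) * Real.exp (-((1 - ε) * Real.log n)) := by
  have h1 : Tendsto (fun n : ℕ => Real.exp (ε * Real.log n) / (Real.log n)) atTop atTop := by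
    have := (tendsto_exp_mul_div_rpow_atTop 1 ε hε).comp tendsto_log_natCast
    simpa [Function.comp_def] using this
  -- `24a = 3 * 8a` makes the product at least `3` before rounding; the floor costs at most `1`.
  filter_upwards [h1.eventually_ge_atTop (24 * a), tendsto_log_natCast.eventually_gt_atTop 0,
    eventually_gt_atTop 0] with n hn hL hn0
  have hn' : (0 : ℝ) < n := by exact_mod_cast hn0
  have h2 : (n : ℝ) / (8 * a * Real.log n) - 1 ≤ sampleSize a n := (Nat.sub_one_lt_floor _).le
  have h3 : Real.exp (-((1 - ε) * Real.log n)) ≤ 1 := by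
    rw [Real.exp_le_one_iff]
    have : 0 ≤ (1 - ε) * Real.log n := mul_nonneg (by linarith) hL.le
    linarith
  have h4 : (n : ℝ) * Real.exp (-((1 - ε) * Real.log n)) = Real.exp (ε * Real.log n) := by
    conv_lhs => rw [← Real.exp_log hn']
    rw [Real.log_exp, ← Real.exp_add]
    congr 1
    ring
  have h5 : 3 ≤ (n : ℝ) / (8 * a * Real.log n) * Real.exp (-((1 - ε) * Real.log n)) := by
    rw [div_mul_eq_mul_div, h4, le_div_iff₀ (by positivity)]
    rw [le_div_iff₀ hL] at hn
    linarith
  have h6 := mul_le_mul_of_nonneg_right h2 (Real.exp_pos (-((1 - ε) * Real.log n))).le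
  linarith

theorem absentLLR_le {a b : ℝ} {n : ℕ} (hb : 0 < b) (hab : b ≤ a) (hp : edgeProb a n < 1) :
    absentLLR a b n ≤ edgeProb a n / (1 - edgeProb a n) := by
  have h1 := edgeProb_nonneg hb.le n
  have h2 := (edgeProb_mono (n := n) hab).trans_lt hp
  refine (Real.log_le_sub_one_of_pos (div_pos (by linarith) (by linarith))).trans ?_
  rw [div_sub_one (by linarith)]
  refine div_le_div_of_nonneg_right ?_ (by linarith)
  linarith

/-- `absentLLR` is `O(log n / n)` and its cofactor `O(√n)`, so after division by `log n` only `T *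
(σ - τ) < β` matters. If `a = b`, the left side vanishes and `c ≥ 0` suffices, even for `β = 0`. -/
theorem eventually_numeric {a b σ τ β : ℝ} (hb : 0 < b) (hab : b ≤ a) (hσ : 0 < σ) (hτ : 0 < τ)
    {α : ℕ → ℝ} (hα : ∀ n, 0 < α n ∧ α n < 1 / 2)
    (hβ : Tendsto (fun n : ℕ => noiseLLR (α n) / Real.log n) atTop (𝓝 β))
    (hT : T a b * (σ - τ) < β ∨ a = b) :
    ∀ᶠ n : ℕ in atTop, T a b * ((⌊σ * Real.log n⌋₊ : ℝ) - ⌊τ * Real.log n⌋₊) + absentLLR a b n *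
      (|(⌊σ * Real.log n⌋₊ : ℝ) - ⌊τ * Real.log n⌋₊| + 2 * √n + 3) ≤ noiseLLR (α n) := by
  have hp := tendsto_edgeProb a
  rcases hT with hT | rfl
  · have h1 := ((tendsto_floor_div_log hσ).sub (tendsto_floor_div_log hτ)).const_mul (T a b)
    have h2 := ((((tendsto_floor_div_self hσ).sub (tendsto_floor_div_self hτ)).abs.add
      (tendsto_sqrt_div.const_mul 2)).add
        ((tendsto_inv_atTop_zero.comp (tendsto_natCast_atTop_atTop (R := ℝ))).const_mul 3)).mul
        ((tendsto_const_nhds (x := a)).div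
          ((tendsto_const_nhds (x := (1 : ℝ))).sub hp) (by norm_num))
    have h3 := h1.add h2
    simp only [sub_zero, abs_zero, mul_zero, add_zero, zero_mul] at h3
    filter_upwards [h3.eventually_lt hβ hT, tendsto_log_natCast.eventually_gt_atTop 0,
      eventually_gt_atTop 0, hp.eventually_lt_const one_pos] with n hn hL hn0 hp1
    have hn' : (0 : ℝ) < n := by exact_mod_cast hn0
    set X : ℝ := (⌊σ * Real.log n⌋₊ : ℝ)
    set Y : ℝ := (⌊τ * Real.log n⌋₊ : ℝ)
    have h4 := mul_le_mul_of_nonneg_right (absentLLR_le hb hab hp1)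
      (show 0 ≤ |X - Y| + 2 * √n + 3 by positivity)
    rw [lt_div_iff₀ hL] at hn
    refine le_trans (add_le_add le_rfl h4) (le_trans (le_of_eq ?_) hn.le)
    have h5 : |X / n - Y / n| = |X - Y| / n := by
      rw [← sub_div, abs_div, abs_of_pos hn']
    have h6 : 1 - edgeProb a n ≠ 0 := by linarith
    simp only [Function.comp_apply, Pi.div_apply, h5]
    have h7 : edgeProb a n / (1 - edgeProb a n)
        = a / (1 - edgeProb a n) * Real.log n / n := by
      conv_lhs => rw [edgeProb]
      rw [edgeProb]
      ring
    rw [h7]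
    field_simp
  · filter_upwards [hp.eventually_lt_const one_pos] with n hp1
    have h1 : absentLLR a a n = 0 := by
      rw [absentLLR, div_self (by linarith), Real.log_one]
    rw [h1, T, div_self hb.ne', Real.log_one]
    simpa using noiseLLR_nonneg (hα n).1 (hα n).2

/-- The failure probability is bounded away from zero as soon as some choice of degrees
`σ * log n` and `τ * log n` into the two communities misleads and is not too unlikely. -/
theorem failureBoundedAwayFromZero_of_rate {a b : ℝ} (hb : 0 < b) (hab : b ≤ a) {α : ℕ → ℝ}
    (hα : ∀ n, 0 < α n ∧ α n < 1 / 2) {σ τ β : ℝ} (hσ : 0 < σ) (hτ : 0 < τ)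
    (hβ : Tendsto (fun n : ℕ => noiseLLR (α n) / Real.log n) atTop (𝓝 β))
    (hT : T a b * (σ - τ) < β ∨ a = b) (hrate : rate a σ + rate b τ + β < 1) :
    FailureBoundedAwayFromZero a b α := by
  have ha : 0 < a := hb.trans_le hab
  -- One `ε` each for the two binomial weights, the noise and the sample size.
  obtain ⟨ε, hε, hε1, hεr⟩ : ∃ ε : ℝ, 0 < ε ∧ ε ≤ 1 ∧ rate a σ + rate b τ + β + 4 * ε ≤ 1 := by
    refine ⟨min 1 ((1 - (rate a σ + rate b τ + β)) / 4), ?_, min_le_left _ _, ?_⟩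
    · exact lt_min one_pos (by linarith)
    · have := min_le_right 1 ((1 - (rate a σ + rate b τ + β)) / 4)
      linarith
  have hw : Tendsto (fun n : ℕ => (√(n : ℝ) + sampleSize a n) / n) atTop (𝓝 0) := by
    have := tendsto_sqrt_div.add (tendsto_sampleSize_div ha)
    simpa [add_div] using this
  refine ⟨1 / 16, by norm_num, ?_⟩
  filter_upwards [eventually_exp_le_binomialWeight ha hσ hε hw,
    eventually_exp_le_binomialWeight hb hτ hε hw, eventually_exp_le_noise hα hε hβ,
    eventually_two_le_sampleSize_mul ha hε hε1, eventually_numeric hb hab hσ hτ hα hβ hT,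
    (tendsto_edgeProb a).eventually_lt_const one_pos, tendsto_log_natCast.eventually_gt_atTop 0,
    eventually_gt_atTop 0, hw.eventually_lt_const (show (0 : ℝ) < 1 / 2 by norm_num)]
    with n hbin1 hbin2 hnoise hsize hnum hp1 hL hn0 hw1
  have hn' : (0 : ℝ) < n := by exact_mod_cast hn0
  refine failsAtLeast_of_le_binomialWeight hb hab (hα n).1 (hα n).2 hp1
    (four_mul_sampleSize_mul_le ha hL hn0) ?_ hsize ?_ hnum
  · rw [div_lt_iff₀ hn'] at hw1
    linarith
  · intro m₁ m₂ hm₁ hm₂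
    have h1 : Real.exp (-((1 - ε) * Real.log n))
        ≤ Real.exp (-((rate a σ + ε) * Real.log n)) * (Real.exp (-((rate b τ + ε) * Real.log n))
          * Real.exp (-((β + ε) * Real.log n))) := by
      rw [← Real.exp_add, ← Real.exp_add, Real.exp_le_exp]
      nlinarith
    have h2 := hbin1 m₁ hm₁
    have h3 := hbin2 m₂ hm₂
    have h4 := (Real.exp_pos (-((rate a σ + ε) * Real.log n))).le.trans h2
    have h5 := (Real.exp_pos (-((rate b τ + ε) * Real.log n))).le.trans h3
    refine h1.trans ?_
    gcongr

/-- A variant of `failureBoundedAwayFromZero_of_rate` allowing equality in the condition on the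
degrees. -/
theorem failureBoundedAwayFromZero_of_rate_of_le {a b : ℝ} (hb : 0 < b) (hab : b < a) {α : ℕ → ℝ}
    (hα : ∀ n, 0 < α n ∧ α n < 1 / 2) {σ τ β : ℝ} (hσ : 0 < σ) (hτ : 0 < τ)
    (hβ : Tendsto (fun n : ℕ => noiseLLR (α n) / Real.log n) atTop (𝓝 β))
    (hT : T a b * (σ - τ) ≤ β) (hrate : rate a σ + rate b τ + β < 1) :
    FailureBoundedAwayFromZero a b α := by
  have hTpos : 0 < T a b := Real.log_pos ((one_lt_div hb).2 hab)
  have hc : ContinuousAt (rate b) τ := by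
    have h1 : ContinuousAt (fun t : ℝ => Real.log (2 * t / b)) τ :=
      ContinuousAt.log (by fun_prop) (by positivity)
    unfold rate
    fun_prop
  -- Raising `τ` slightly makes the degree condition strict, because `T > 0`, and keeps the rate
  -- condition by continuity.
  have h2 : ∀ᶠ t in 𝓝[>] τ, rate b t < 1 - β - rate a σ :=
    (hc.eventually_lt_const (by linarith)).filter_mono nhdsWithin_le_nhds
  obtain ⟨t, ht, htτ⟩ := (h2.and self_mem_nhdsWithin).exists
  refine failureBoundedAwayFromZero_of_rate hb hab.le hα hσ (hτ.trans htτ) hβ (.inl ?_)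
    (by linarith)
  have : T a b * (σ - t) < T a b * (σ - τ) :=
    mul_lt_mul_of_pos_left (by linarith) hTpos
  linarith

/-! ### The degree profiles for the three cases -/

theorem rate_half {s : ℝ} (hs : 0 < s) : rate s (s / 2) = 0 := by
  rw [rate, mul_div_cancel₀ _ (two_ne_zero), div_self hs.ne', Real.log_one]
  ring

/-- The logarithms of `√(b/a)` and `√(a/b)` cancel, leaving `(a + b) / 2 - √(ab)`. -/
theorem rate_sqrt_add_rate_sqrt {a b : ℝ} (ha : 0 < a) (hb : 0 < b) :
    rate a (√(a * b) / 2) + rate b (√(a * b) / 2) = (√a - √b) ^ 2 / 2 := by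
  have h1 : 0 < √(a * b) := by positivity
  rw [rate, rate, sub_sq, Real.sq_sqrt ha.le, Real.sq_sqrt hb.le, mul_assoc 2 (√a),
    ← Real.sqrt_mul ha.le, mul_div_cancel₀ _ (two_ne_zero), Real.log_div h1.ne' ha.ne',
    Real.log_div h1.ne' hb.ne', Real.log_sqrt (by positivity), Real.log_mul ha.ne' hb.ne']
  ring

theorem abs_lt_gamma {a b β : ℝ} (ha : 0 < a) (hb : 0 < b) (hT : T a b ≠ 0) :
    |β| < gamma a b β := by
  rw [gamma, ← Real.sqrt_sq_eq_abs]
  refine Real.sqrt_lt_sqrt (sq_nonneg _) ?_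
  have : 0 < a * b * T a b ^ 2 := by positivity
  linarith

/-- These degrees solve `T * (σ - τ) = β` and `4στ = ab`, the stationarity condition on that line.
-/
theorem rate_add_rate_eq_eta {a b β : ℝ} (ha : 0 < a) (hb : 0 < b) (hT : 0 < T a b) :
    rate a ((gamma a b β + β) / (2 * T a b)) + rate b ((gamma a b β - β) / (2 * T a b)) + β
      = eta a b β / 2 := by
  have hg := abs_lt.1 (abs_lt_gamma (β := β) ha hb hT.ne')
  have hu : 0 < gamma a b β + β := by linarith [hg.1]
  have hv : 0 < gamma a b β - β := by linarith [hg.2]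
  -- Logarithm of `(γ + β)(γ - β) = ab T²`; with `T = log a - log b` it expresses both rate
  -- logarithms through `U - V` and `T`.
  have huv : Real.log (gamma a b β + β) + Real.log (gamma a b β - β)
      = Real.log a + Real.log b + 2 * Real.log (T a b) := by
    rw [← Real.log_mul hu.ne' hv.ne', ← Real.log_mul ha.ne' hb.ne', ← Nat.cast_two, ← Real.log_pow,
      ← Real.log_mul (by positivity) (by positivity)]
    congr 1
    have : gamma a b β ^ 2 = β ^ 2 + a * b * T a b ^ 2 := Real.sq_sqrt (by positivity)
    linarith
  have hTl : T a b = Real.log a - Real.log b := Real.log_div ha.ne' hb.ne'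
  have e1 : Real.log (2 * ((gamma a b β + β) / (2 * T a b)) / a)
      = Real.log (gamma a b β + β) - Real.log (T a b) - Real.log a := by
    rw [← Real.log_div hu.ne' hT.ne', ← Real.log_div (by positivity) ha.ne']
    congr 1
    field_simp
  have e2 : Real.log (2 * ((gamma a b β - β) / (2 * T a b)) / b)
      = Real.log (gamma a b β - β) - Real.log (T a b) - Real.log b := by
    rw [← Real.log_div hv.ne' hT.ne', ← Real.log_div (by positivity) hb.ne']
    congr 1
    field_simp
  rw [rate, rate, eta, e1, e2, Real.log_div hu.ne' hv.ne']
  set t := T a b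
  set U := Real.log (gamma a b β + β)
  set V := Real.log (gamma a b β - β)
  have e3 : U - Real.log t - Real.log a = (U - V) / 2 - t / 2 := by linarith
  have e4 : V - Real.log t - Real.log b = -((U - V) / 2) + t / 2 := by linarith
  rw [e3, e4]
  field_simp
  ring

end NoisySBM

theorem theorem1 (a b : ℝ) (hb : 0 < b) (hab : b ≤ a)
    (α : ℕ → ℝ) (hα : ∀ n, 0 < α n ∧ α n < 1 / 2) :
    -- c = o(log n) and (√a - √b)² < 2
    ((fun n : ℕ => NoisySBM.noiseLLR (α n)) =o[Filter.atTop] (fun n : ℕ => Real.log n) →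
      (Real.sqrt a - Real.sqrt b) ^ 2 < 2 →
      NoisySBM.FailureBoundedAwayFromZero a b α) ∧
    -- c = (β + o(1)) log n with 0 < β < T (a - b) / 2, and η(a, b, β) < 2
    (∀ β : ℝ,
      Filter.Tendsto (fun n : ℕ => NoisySBM.noiseLLR (α n) / Real.log n) Filter.atTop (nhds β) →
      0 < β → β < NoisySBM.T a b * (a - b) / 2 →
      NoisySBM.eta a b β < 2 →
      NoisySBM.FailureBoundedAwayFromZero a b α) ∧
    -- c = (β + o(1)) log n with β > T (a - b) / 2, and β < 1
    (∀ β : ℝ,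
      Filter.Tendsto (fun n : ℕ => NoisySBM.noiseLLR (α n) / Real.log n) Filter.atTop (nhds β) →
      NoisySBM.T a b * (a - b) / 2 < β →
      β < 1 →
      NoisySBM.FailureBoundedAwayFromZero a b α) := by
  have ha : 0 < a := hb.trans_le hab
  refine ⟨fun hc hsq => ?_, fun β hβ hβ0 hβT heta => ?_, fun β hβ hβT hβ1 => ?_⟩
  · have hσ : 0 < √(a * b) / 2 := by positivity
    have hrate := NoisySBM.rate_sqrt_add_rate_sqrt ha hb
    -- With `a = b` one has `T = 0`, so the degree condition cannot be made strict by moving `τ`.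
    rcases hab.eq_or_lt with h | h
    · exact NoisySBM.failureBoundedAwayFromZero_of_rate hb hab hα hσ hσ hc.tendsto_div_nhds_zero
        (.inr h.symm) (by linarith)
    · exact NoisySBM.failureBoundedAwayFromZero_of_rate_of_le hb h hα hσ hσ
        hc.tendsto_div_nhds_zero (by simp) (by linarith)
  · have hlt : b < a := by
      rcases hab.eq_or_lt with rfl | h
      · simp at hβT
        linarith
      · exact h
    have hT : 0 < NoisySBM.T a b := Real.log_pos ((one_lt_div hb).2 hlt)
    have hg := abs_lt.1 (NoisySBM.abs_lt_gamma (β := β) ha hb hT.ne')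
    have hrate := NoisySBM.rate_add_rate_eq_eta (β := β) ha hb hT
    refine NoisySBM.failureBoundedAwayFromZero_of_rate_of_le hb hlt hα
      (div_pos (by linarith [hg.1]) (by positivity)) (div_pos (by linarith [hg.2]) (by positivity))
      hβ (le_of_eq ?_) (hrate.trans_lt (by linarith))
    field_simp
    ring
  -- Typical degrees already mislead, so only the wrong noisy label, of exponent `β`, has to be paid
  -- for.
  · refine NoisySBM.failureBoundedAwayFromZero_of_rate hb hab hα (half_pos ha) (half_pos hb) hβ
      (.inl (by linarith)) ?_
    rw [NoisySBM.rate_half ha, NoisySBM.rate_half hb]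
    linarith
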